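/- Let $d\ge 1$ be an integer and let $|\cdot|$ be the Euclidean norm on $\mathbb R^d$. For a finite set $\omega\subset\mathbb R^d$ and $s>0$ let $$E_s(\omega)=\sum_{y\in\omega}\ \sum_{x\in\omega,\,x\ne y}\frac1{|x-y|^s},$$ and for $A\subset\mathbb R^d$ and $N\in\mathbb N$ let $\mathcal E_s(A,N)=\inf E_s(\omega)\in[0,\infty]$, where the infimum is over all sets $\omega\subset A$ of exactly $N$ distinct points (and the infimum over the empty set is $\infty$). Let $\mathcal H_d$ be $d$-dimensional Hausdorff measure on $\mathbb R^d$, normalized so that the unit cube has measure $1$ (i.e. Lebesgue measure), and let $\mathcal B^d$ be the closed unit ball of $\mathbb R^d$. Quotients are taken in $[0,\infty]$, with $c/0=\infty$ for $c>0$. (a) For every compact $A\subset\mathbb R^d$, $$\lim_{N\to\infty}\frac{\mathcal E_d(A,N)}{N^2\log N}=\frac{\mathcal H_d(\mathcal B^d)}{\mathcal H_d(A)}.$$ (b) For every real $s>d$ there is a constant $C_{s,d}$ with $0<C_{s,d}<\infty$, depending only on $s$ and $d$, such that for every compact $A\subset\mathbb R^d$ the limit $\lim_{N\to\infty}\mathcal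 E_s(A,N)/N^{1+s/d}$ exists in $[0,\infty]$ and $$\lim_{N\to\infty}\frac{\mathcal E_s(A,N)}{N^{1+s/d}}=\frac{C_{s,d}}{\mathcal H_d(A)^{s/d}}.$$ In particular, if $\mathcal H_d(A)=0$, then the limits in (a) and (b) are $+\infty$. -/

import Mathlib

open Filter Topology MeasureTheory
open scoped ENNReal

noncomputable section

open Classical in
/-- The Riesz `s`-energy of a finite set `ω` of (distinct) points: the sum of `1 / |x - y| ^ s`
over all ordered pairs of different points of `ω`. -/
def rieszEnergy {X : Type*} [MetricSpace X] (s : ℝ) (ω : Finset X) : ℝ :=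
  ∑ y ∈ ω, ∑ x ∈ ω.erase y, 1 / dist x y ^ s

/-- The `N`-point minimal `s`-energy over `A`: the infimum of the `s`-energy over all subsets of
`A` with exactly `N` points, with values in `[0, ∞]`; it is `∞` if `A` has fewer than `N` points. -/
def minRieszEnergy {X : Type*} [MetricSpace X] (s : ℝ) (A : Set X) (N : ℕ) : ℝ≥0∞ :=
  ⨅ (ω : Finset X) (_ : (ω : Set X) ⊆ A) (_ : ω.card = N), ENNReal.ofReal (rieszEnergy s ω)

end

/-! Upper bounds, for every `s`, come from averaging. Take a finite set `F` in the unit cube,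
rescale `A` by `h⁻¹`, and intersect it with a random translate of `F + ℤ^d`. The mean number of
points is `|F|` times the volume, and the mean energy is at most the volume times the sum of the
potentials of the periodic configuration. The counts are also bounded above uniformly, by the volume
of a thickening of `A`, so one translate has almost the mean number of points and almost the mean
energy (`minRieszEnergy_le_of_periodic`).

For `s = d` take `F = {0}`. Comparison with an integral bounds the truncated lattice sum by about `d
v log R`, with `v` the volume of the unit ball. Since `R` is of order `N^(1/d)`, this is about `v
log N`. For the matching lower bound, write `Γ(d/2) |x|^(-d)` as the integral of `t^(d/2-1)
exp(-t|x|²)` over `t > 0`. Each Gaussian is, up to a constant, a self-convolution, so Cauchy–Schwarz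
bounds its double sum below by about `N² (π/t)^(d/2) / vol A`. Integrating from a fixed `T` to
`N^(2/d)` turns `dt/t` into `(2/d) log N`, and the constants agree by the formula for the volume of
the ball.

For `s > d` let `C` be the lower limit of the normalized energies of the half-open unit cube.
Cutting space into small cubes and using convexity of `n^(1+s/d)` carries this lower bound to every
compact set (`eventually_le_minRieszEnergy_div`). Conversely, one near-optimal configuration in the
cube, slightly shrunk and then periodized, has cross-cell energy only `O(n²) = o(n^(1+s/d))`, so
averaging makes it serve all large `N` (`frequently_lt_imp_eventually_le`). Thus the same `C` bounds
the lower limit from below and the upper limit from above. Crude versions of the two arguments show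
`0 < C < ∞`. -/

noncomputable section

/-! ### Elementary properties of the Riesz energy -/

section Energy

variable {X Y : Type*} [MetricSpace X] [MetricSpace Y] {s : ℝ}

/-- The definition fixes the classical decidability instance; this form is valid for any instance.
-/
lemma rieszEnergy_eq [DecidableEq X] (s : ℝ) (ω : Finset X) :
    rieszEnergy s ω = ∑ y ∈ ω, ∑ x ∈ ω.erase y, 1 / dist x y ^ s := by
  unfold rieszEnergy
  refine Finset.sum_congr rfl fun y _ => Finset.sum_congr ?_ fun _ _ => rfl
  ext x
  simp only [Finset.mem_erase]

lemma rieszEnergy_nonneg (s : ℝ) (ω : Finset X) : 0 ≤ rieszEnergy s ω :=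
  Finset.sum_nonneg fun _ _ => Finset.sum_nonneg fun _ _ => by positivity

lemma rieszEnergy_mono (s : ℝ) {ω ω' : Finset X} (h : ω ⊆ ω') :
    rieszEnergy s ω ≤ rieszEnergy s ω' := by
  classical
  rw [rieszEnergy_eq, rieszEnergy_eq]
  calc _ ≤ ∑ y ∈ ω, ∑ x ∈ ω'.erase y, 1 / dist x y ^ s :=
        Finset.sum_le_sum fun y _ => Finset.sum_le_sum_of_subset_of_nonneg
          (Finset.erase_subset_erase _ h) fun _ _ _ => by positivity
    _ ≤ _ := Finset.sum_le_sum_of_subset_of_nonneg h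
          fun _ _ _ => Finset.sum_nonneg fun _ _ => by positivity

/-- Discarding points only lowers the energy, so a configuration with too many points will do. The
averaging argument controls the cardinality only from below. -/
lemma minRieszEnergy_le {A : Set X} {ω : Finset X} (hω : (ω : Set X) ⊆ A) {m : ℕ}
    (hm : m ≤ ω.card) : minRieszEnergy s A m ≤ ENNReal.ofReal (rieszEnergy s ω) := by
  obtain ⟨ω', hsub, hcard⟩ := Finset.exists_subset_card_eq hm
  have h' : (ω' : Set X) ⊆ A := (Finset.coe_subset.2 hsub).trans hω
  exact ((iInf_le _ ω').trans <| (iInf_le _ h').trans <| iInf_le _ hcard).trans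
    (ENNReal.ofReal_le_ofReal (rieszEnergy_mono s hsub))

lemma le_minRieszEnergy {A : Set X} {m : ℕ} {c : ℝ≥0∞}
    (h : ∀ ω : Finset X, (ω : Set X) ⊆ A → ω.card = m → c ≤ ENNReal.ofReal (rieszEnergy s ω)) :
    c ≤ minRieszEnergy s A m :=
  le_iInf fun ω => le_iInf fun h₁ => le_iInf fun h₂ => h ω h₁ h₂

lemma exists_rieszEnergy_lt {A : Set X} {m : ℕ} {c : ℝ≥0∞} (h : minRieszEnergy s A m < c) :
    ∃ ω : Finset X, (ω : Set X) ⊆ A ∧ ω.card = m ∧ ENNReal.ofReal (rieszEnergy s ω) < c := by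
  simp only [minRieszEnergy, iInf_lt_iff] at h
  obtain ⟨ω, h₁, h₂, h₃⟩ := h
  exact ⟨ω, h₁, h₂, h₃⟩

lemma minRieszEnergy_anti {A B : Set X} (h : A ⊆ B) (m : ℕ) :
    minRieszEnergy s B m ≤ minRieszEnergy s A m :=
  le_minRieszEnergy fun _ h₁ h₂ => minRieszEnergy_le (h₁.trans h) h₂.ge

lemma rieszEnergy_image [DecidableEq Y] {c : ℝ} (hc : 0 < c) {f : X → Y}
    (hf : ∀ x y, dist (f x) (f y) = c * dist x y) (s : ℝ) (ω : Finset X) :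
    rieszEnergy s (ω.image f) = c ^ (-s) * rieszEnergy s ω := by
  classical
  have hinj : Function.Injective f := fun x y h => by
    have := hf x y
    rw [h, dist_self] at this
    exact dist_eq_zero.1 ((mul_eq_zero.1 this.symm).resolve_left hc.ne')
  rw [rieszEnergy_eq, rieszEnergy_eq, Finset.sum_image hinj.injOn, Finset.mul_sum]
  refine Finset.sum_congr rfl fun y _ => ?_
  rw [← Finset.image_erase hinj, Finset.sum_image hinj.injOn, Finset.mul_sum]
  refine Finset.sum_congr rfl fun x _ => ?_
  rw [hf, Real.mul_rpow hc.le dist_nonneg, Real.rpow_neg hc.le, one_div, mul_inv, one_div]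

lemma minRieszEnergy_image_le {c : ℝ} (hc : 0 < c) {f : X → Y}
    (hf : ∀ x y, dist (f x) (f y) = c * dist x y) (A : Set X) (m : ℕ) {e : ℝ}
    (he : minRieszEnergy s A m ≤ ENNReal.ofReal e) :
    minRieszEnergy s (f '' A) m ≤ ENNReal.ofReal (c ^ (-s) * e) := by
  classical
  have hinj : Function.Injective f := fun x y h => by
    have := hf x y
    rw [h, dist_self] at this
    exact dist_eq_zero.1 ((mul_eq_zero.1 this.symm).resolve_left hc.ne')
  have hcs : 0 < c ^ (-s) := Real.rpow_pos_of_pos hc _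
  refine le_of_forall_gt fun b hb => ?_
  rw [ENNReal.ofReal_mul hcs.le, mul_comm] at hb
  have h0 : ENNReal.ofReal (c ^ (-s)) ≠ 0 := by simpa using hcs
  have hlt : minRieszEnergy s A m < b / ENNReal.ofReal (c ^ (-s)) :=
    he.trans_lt ((ENNReal.lt_div_iff_mul_lt (.inl h0) (.inl ENNReal.ofReal_ne_top)).2 hb)
  obtain ⟨ω, h₁, h₂, h₃⟩ := exists_rieszEnergy_lt hlt
  refine lt_of_le_of_lt (minRieszEnergy_le (ω := ω.image f) ?_ ?_) ?_
  · simpa using Set.image_mono h₁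
  · rw [Finset.card_image_of_injective _ hinj, h₂]
  · rw [rieszEnergy_image hc hf, ENNReal.ofReal_mul hcs.le, mul_comm]
    exact (ENNReal.lt_div_iff_mul_lt (.inl h0) (.inl ENNReal.ofReal_ne_top)).1 h₃

/-- Only the interactions between different fibres of `g` are dropped. -/
lemma sum_rieszEnergy_filter_le {ι : Type*} [DecidableEq ι] (s : ℝ) (ω : Finset X) (g : X → ι) :
    ∑ k ∈ ω.image g, rieszEnergy s (ω.filter (g · = k)) ≤ rieszEnergy s ω := by
  classical
  rw [rieszEnergy_eq s ω, ← Finset.sum_fiberwise_of_maps_to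
    (fun x hx => Finset.mem_image_of_mem g hx)]
  refine Finset.sum_le_sum fun k _ => ?_
  rw [rieszEnergy_eq]
  exact Finset.sum_le_sum fun y _ => Finset.sum_le_sum_of_subset_of_nonneg
    (Finset.erase_subset_erase _ (Finset.filter_subset _ _)) fun _ _ _ => by positivity

/-- The quadratic count of pairs is weakened to a linear one, which adds up well over many cells and
is harmless for empty ones. -/
lemma card_mul_le_rieszEnergy (hs : 0 ≤ s) {r : ℝ} (hr : 0 < r) (ω : Finset X)
    (hω : ∀ x ∈ ω, ∀ y ∈ ω, dist x y ≤ r) :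
    r ^ (-s) * ((ω.card : ℝ) - 1) ≤ rieszEnergy s ω := by
  classical
  rw [rieszEnergy_eq]
  have hrs : 0 < r ^ (-s) := Real.rpow_pos_of_pos hr _
  have key : ∀ y ∈ ω, r ^ (-s) * ((ω.card : ℝ) - 1) ≤ ∑ x ∈ ω.erase y, 1 / dist x y ^ s := by
    intro y hy
    have h1 : ((ω.erase y).card : ℝ) = ω.card - 1 := by
      rw [Finset.card_erase_of_mem hy, Nat.cast_sub (Finset.card_pos.2 ⟨y, hy⟩), Nat.cast_one]
    rw [← h1, mul_comm, ← nsmul_eq_mul]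
    refine Finset.card_nsmul_le_sum _ _ _ fun x hx => ?_
    have hxy : 0 < dist x y := dist_pos.2 (Finset.ne_of_mem_erase hx)
    rw [Real.rpow_neg hr.le, one_div]
    exact inv_anti₀ (by positivity) (Real.rpow_le_rpow hxy.le
      (hω x (Finset.mem_of_mem_erase hx) y hy) hs)
  rcases ω.eq_empty_or_nonempty with rfl | hne
  · simp [hrs.le]
  · have hc : (1 : ℝ) ≤ ω.card := by exact_mod_cast hne.card_pos
    calc _ = 1 * (r ^ (-s) * ((ω.card : ℝ) - 1)) := (one_mul _).symm
      _ ≤ ω.card * (r ^ (-s) * ((ω.card : ℝ) - 1)) :=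
        mul_le_mul_of_nonneg_right hc (mul_nonneg hrs.le (by linarith))
      _ ≤ _ := by rw [← nsmul_eq_mul]; exact Finset.card_nsmul_le_sum _ _ _ key

end Energy

/-! ### The standard lattice and its unit cell -/

section Lattice

variable {d : ℕ}

/-- The standard basis of `ℝ^d`. -/
abbrev stdBasis (d : ℕ) : Module.Basis (Fin d) ℝ (EuclideanSpace ℝ (Fin d)) :=
  (EuclideanSpace.basisFun (Fin d) ℝ).toBasis

/-- The lattice `ℤ^d` in `ℝ^d`. -/
abbrev stdLattice (d : ℕ) : Submodule ℤ (EuclideanSpace ℝ (Fin d)) :=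
  Submodule.span ℤ (Set.range (stdBasis d))

/-- The half-open unit cube `[0, 1)^d`. -/
abbrev unitCell (d : ℕ) : Set (EuclideanSpace ℝ (Fin d)) :=
  ZSpan.fundamentalDomain (stdBasis d)

lemma mem_unitCell {x : EuclideanSpace ℝ (Fin d)} :
    x ∈ unitCell d ↔ ∀ i, 0 ≤ x i ∧ x i < 1 := by
  simp [ZSpan.mem_fundamentalDomain]

lemma measurableSet_unitCell : MeasurableSet (unitCell d) :=
  ZSpan.fundamentalDomain_measurableSet _

lemma volume_unitCell : volume (unitCell d) = 1 := by
  rw [measure_congr (ZSpan.fundamentalDomain_ae_parallelepiped _ _)]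
  simpa using (EuclideanSpace.basisFun (Fin d) ℝ).volume_parallelepiped

lemma norm_le_of_mem_unitCell {x : EuclideanSpace ℝ (Fin d)} (hx : x ∈ unitCell d) :
    ‖x‖ ≤ d := by
  have := ZSpan.norm_fract_le (stdBasis d) x
  rw [ZSpan.fract_eq_self.2 hx] at this
  simpa using this

lemma exists_int_coord (k : stdLattice d) (i : Fin d) :
    ∃ m : ℤ, (k : EuclideanSpace ℝ (Fin d)) i = m := by
  have h := (stdBasis d).mem_span_iff_repr_mem ℤ (k : EuclideanSpace ℝ (Fin d))
  obtain ⟨m, hm⟩ := h.1 k.2 i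
  exact ⟨m, by simpa using hm.symm⟩

lemma lintegral_eq_tsum_unitCell (f : EuclideanSpace ℝ (Fin d) → ℝ≥0∞) :
    ∫⁻ x, f x = ∑' k : stdLattice d, ∫⁻ x in unitCell d, f (k + x) := by
  have : Countable (stdLattice d).toAddSubgroup := inferInstanceAs (Countable (stdLattice d))
  exact IsAddFundamentalDomain.lintegral_eq_tsum''
    (ZSpan.isAddFundamentalDomain' (stdBasis d) volume) f

/-- The lattice translates of the unit cell tile space, so integrating the count over one cell
recovers the whole volume. -/
lemma lintegral_tsum_indicator {A : Set (EuclideanSpace ℝ (Fin d))} (hA : MeasurableSet A)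
    (v : EuclideanSpace ℝ (Fin d)) :
    ∫⁻ t in unitCell d, ∑' k : stdLattice d,
        A.indicator (1 : EuclideanSpace ℝ (Fin d) → ℝ≥0∞) (k + t + v)
      = volume A := by
  have hm : Measurable (A.indicator (1 : EuclideanSpace ℝ (Fin d) → ℝ≥0∞)) :=
    measurable_one.indicator hA
  have hm' (k : stdLattice d) : Measurable fun t : EuclideanSpace ℝ (Fin d) =>
      A.indicator (1 : EuclideanSpace ℝ (Fin d) → ℝ≥0∞) (k + t + v) := hm.comp (by fun_prop)
  rw [lintegral_tsum fun k => (hm' k).aemeasurable,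
    ← lintegral_eq_tsum_unitCell fun x => A.indicator 1 (x + v), lintegral_add_right_eq_self,
    lintegral_indicator_one hA]

/-- Disjoint translates of the unit cell inside a set of finite volume: the packing bound. -/
lemma tsum_indicator_le_volume {A S : Set (EuclideanSpace ℝ (Fin d))} (v : EuclideanSpace ℝ (Fin d))
    (h : ∀ k : stdLattice d, ↑k + v ∈ A → ∀ x ∈ unitCell d, ↑k + x ∈ S) (hS : MeasurableSet S) :
    ∑' k : stdLattice d, A.indicator (1 : EuclideanSpace ℝ (Fin d) → ℝ≥0∞) (k + v) ≤ volume S := by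
  rw [← lintegral_indicator_one hS, lintegral_eq_tsum_unitCell]
  refine ENNReal.tsum_le_tsum fun k => ?_
  by_cases hk : (k : EuclideanSpace ℝ (Fin d)) + v ∈ A
  · have : ∀ x ∈ unitCell d, S.indicator (1 : EuclideanSpace ℝ (Fin d) → ℝ≥0∞) (k + x) = 1 := by
      intro x hx
      simp [h k hk x hx]
    rw [setLIntegral_congr_fun measurableSet_unitCell this]
    simp [hk, volume_unitCell]
  · simp [hk]

/-- The term `k = 0` vanishes by the convention `0 ^ (-s) = 0` for `s ≠ 0`. -/
lemma tsum_lattice_rpow_lt_top {s : ℝ} (hs : (d : ℝ) < s) :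
    ∑' k : stdLattice d, ENNReal.ofReal (‖(k : EuclideanSpace ℝ (Fin d))‖ ^ (-s)) < ∞ := by
  have hfr : Module.finrank ℤ (stdLattice d) = d := by
    rw [ZLattice.rank ℝ]; simp
  have := ZLattice.summable_norm_rpow (stdLattice d) (-s) (by rw [hfr]; linarith)
  exact this.tsum_ofReal_lt_top

/-- Coordinatewise: two points of the shrunken cell differ by at most `1 - η`, and a nonzero integer
`m` satisfies `|m| - (1 - η) ≥ η |m|`. Shrinking keeps points of different cells apart in proportion
to `‖k‖`. -/
lemma norm_lattice_le {η : ℝ} (hη0 : 0 < η) (hη1 : η < 1) {x y : EuclideanSpace ℝ (Fin d)}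
    (hx : x ∈ unitCell d) (hy : y ∈ unitCell d) (k : stdLattice d) :
    η * ‖(k : EuclideanSpace ℝ (Fin d))‖ ≤ ‖(1 - η) • x - (1 - η) • y - k‖ := by
  have : η * ‖(k : EuclideanSpace ℝ (Fin d))‖ = ‖η • (k : EuclideanSpace ℝ (Fin d))‖ := by
    rw [norm_smul, Real.norm_of_nonneg hη0.le]
  rw [this, EuclideanSpace.norm_eq, EuclideanSpace.norm_eq]
  refine Real.sqrt_le_sqrt (Finset.sum_le_sum fun i _ => ?_)
  obtain ⟨m, hm⟩ := exists_int_coord k i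
  have hx := mem_unitCell.1 hx i
  have hy := mem_unitCell.1 hy i
  simp only [PiLp.smul_apply, PiLp.sub_apply, smul_eq_mul, hm]
  refine pow_le_pow_left₀ (norm_nonneg _) ?_ 2
  simp only [Real.norm_eq_abs]
  rcases lt_trichotomy m 0 with h | h | h
  · have : (m : ℝ) ≤ -1 := by exact_mod_cast Int.le_sub_one_of_lt h
    rw [abs_of_nonpos (by nlinarith), abs_of_nonneg (by nlinarith)]
    nlinarith
  · simp [h]
  · have : (1 : ℝ) ≤ m := by exact_mod_cast h
    rw [abs_of_nonneg (by nlinarith), abs_of_nonpos (by nlinarith)]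
    nlinarith

/-- The Riesz kernel `1 / |x| ^ s`, set to `0` at the origin and outside the ball of radius `R`. -/
def truncKernel (s R : ℝ) (x : EuclideanSpace ℝ (Fin d)) : ℝ≥0∞ :=
  if x ≠ 0 ∧ ‖x‖ ≤ R then ENNReal.ofReal (‖x‖ ^ (-s)) else 0

lemma truncKernel_le (s R : ℝ) (x : EuclideanSpace ℝ (Fin d)) :
    truncKernel s R x ≤ ENNReal.ofReal (‖x‖ ^ (-s)) := by
  unfold truncKernel
  split_ifs <;> simp

lemma truncKernel_zero (s R : ℝ) : truncKernel s R (0 : EuclideanSpace ℝ (Fin d)) = 0 := by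
  simp [truncKernel]

/-- In polar coordinates the exponent `-d` cancels the Jacobian and leaves `dy / y`. -/
lemma lintegral_norm_rpow_shell (hd : 1 ≤ d) {M ρ : ℝ} (hM : 0 < M) (hρ : M ≤ ρ) :
    ∫⁻ x : EuclideanSpace ℝ (Fin d),
      ENNReal.ofReal ((Set.Ioc M ρ).indicator (fun y : ℝ => y ^ (-(d : ℝ))) ‖x‖)
      = ENNReal.ofReal (d * volume.real (Metric.ball (0 : EuclideanSpace ℝ (Fin d)) 1) *
        Real.log (ρ / M)) := by
  have : Nonempty (Fin d) := ⟨⟨0, hd⟩⟩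
  have hfr : Module.finrank ℝ (EuclideanSpace ℝ (Fin d)) = d := by simp
  set f : ℝ → ℝ := (Set.Ioc M ρ).indicator (fun y : ℝ => y ^ (-(d : ℝ))) with hf
  have hcongr : Set.EqOn (fun y : ℝ => y ^ (d - 1) • f y) ((Set.Ioc M ρ).indicator fun y => y⁻¹)
      (Set.Ioi 0) := by
    intro y hy
    have hy : 0 < y := hy
    by_cases h : y ∈ Set.Ioc M ρ
    · simp only [hf, Set.indicator_of_mem h, smul_eq_mul]
      rw [Real.rpow_neg hy.le, Real.rpow_natCast]
      obtain ⟨n, rfl⟩ : ∃ n, d = n + 1 := ⟨d - 1, by omega⟩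
      rw [Nat.add_sub_cancel, pow_succ]
      field_simp
    · simp [hf, h]
  have hsub : Set.Ioc M ρ ⊆ Set.Ioi (0 : ℝ) := fun y hy => hM.trans hy.1
  have hinv : IntegrableOn (fun y : ℝ => y⁻¹) (Set.Ioc M ρ) := by
    rw [← intervalIntegrable_iff_integrableOn_Ioc_of_le hρ]
    exact intervalIntegral.intervalIntegrable_inv (fun x hx => by
      rw [Set.uIcc_of_le hρ] at hx; exact (hM.trans_le hx.1).ne') continuousOn_id
  have hintegrable : Integrable fun x : EuclideanSpace ℝ (Fin d) => f ‖x‖ := by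
    rw [integrable_fun_norm_addHaar, hfr, integrableOn_congr_fun hcongr measurableSet_Ioi]
    exact ((integrable_indicator_iff measurableSet_Ioc).2 hinv).integrableOn
  have hnonneg (x : EuclideanSpace ℝ (Fin d)) : 0 ≤ f ‖x‖ :=
    Set.indicator_nonneg (fun y hy => Real.rpow_nonneg (hM.trans hy.1).le _) _
  rw [← ofReal_integral_eq_lintegral_ofReal hintegrable (ae_of_all _ hnonneg),
    integral_fun_norm_addHaar, hfr, setIntegral_congr_fun measurableSet_Ioi hcongr,
    setIntegral_indicator measurableSet_Ioc, Set.inter_eq_self_of_subset_right hsub,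
    ← intervalIntegral.integral_of_le hρ, integral_inv_of_pos hM (hM.trans_le hρ)]
  simp [mul_assoc]

/-- Each distant lattice term is compared with the integral of the kernel over its cell, at the cost
of a factor `1 + ε`; the finitely many near terms go into `K`. -/
lemma exists_tsum_truncKernel_le (hd : 1 ≤ d) {ε : ℝ} (hε : 0 < ε) :
    ∃ K : ℝ, ∀ ρ : ℝ, 1 ≤ ρ →
      ∑' k : stdLattice d, truncKernel (d : ℝ) ρ (k : EuclideanSpace ℝ (Fin d))
      ≤ ENNReal.ofReal ((1 + ε) * (d * volume.real (Metric.ball (0 : EuclideanSpace ℝ (Fin d)) 1)) *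
        Real.log ρ + K) := by
  set v := volume.real (Metric.ball (0 : EuclideanSpace ℝ (Fin d)) 1)
  have hd0 : (0 : ℝ) < d := by exact_mod_cast hd
  -- Beyond `M`, moving within a cell, which changes the norm by at most `d`, changes the kernel by
  -- a factor of at most `1 + ε`.
  obtain ⟨M, hM1, hM⟩ : ∃ M : ℝ, (d : ℝ) + 1 ≤ M ∧ ∀ y, M ≤ y →
      (y - d) ^ (-(d : ℝ)) ≤ (1 + ε) * y ^ (-(d : ℝ)) := by
    have h1 : Tendsto (fun y : ℝ => (1 - d * y⁻¹) ^ (-(d : ℝ))) atTop (𝓝 1) := by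
      have : Tendsto (fun y : ℝ => 1 - d * y⁻¹) atTop (𝓝 (1 - d * 0)) :=
        (tendsto_inv_atTop_zero.const_mul _).const_sub _
      simpa using this.rpow_const (p := -(d : ℝ)) (Or.inl (by simp))
    obtain ⟨M, hM⟩ := eventually_atTop.1
      (h1.eventually (ge_mem_nhds (show (1 : ℝ) < 1 + ε by linarith)))
    refine ⟨max M (d + 1), le_max_right _ _, fun y hy => ?_⟩
    have hy1 := hM y ((le_max_left _ _).trans hy)
    have hy2 : (d : ℝ) + 1 ≤ y := (le_max_right _ _).trans hy
    have hy0 : 0 < y := by linarith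
    have : y - d = (1 - d * y⁻¹) * y := by field_simp
    rw [this, Real.mul_rpow _ hy0.le]
    · gcongr
    · rw [sub_nonneg, ← div_eq_mul_inv, div_le_one hy0]; linarith
  have hM0 : 0 < M := by linarith
  set T : Set (stdLattice d) := {k | ‖(k : EuclideanSpace ℝ (Fin d))‖ ≤ M + d}
  have hT : T.Finite := by
    have := ZSpan.setFinite_inter (stdBasis d)
      (Metric.isBounded_closedBall (x := (0 : EuclideanSpace ℝ (Fin d))) (r := M + d))
    refine (this.preimage (f := fun k : stdLattice d => (k : EuclideanSpace ℝ (Fin d)))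
      Subtype.val_injective.injOn).subset fun k hk => ?_
    exact ⟨mem_closedBall_zero_iff.2 hk, k.2⟩
  set K₀ : ℝ := ∑ k ∈ hT.toFinset, ‖(k : EuclideanSpace ℝ (Fin d))‖ ^ (-(d : ℝ))
  have hK₀ : 0 ≤ K₀ := Finset.sum_nonneg fun _ _ => by positivity
  refine ⟨(1 + ε) * (d * v) * (Real.log (1 + d) ) + K₀ + (1 + ε) * (d * v) * |Real.log M|,
    fun ρ hρ => ?_⟩
  have hv : 0 ≤ v := measureReal_nonneg
  -- The cell of a lattice point of norm at most `ρ` reaches norm `ρ + d`. The maximum keeps the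
  -- shell well formed when `ρ + d < M`.
  set g : EuclideanSpace ℝ (Fin d) → ℝ≥0∞ := fun x => ENNReal.ofReal (1 + ε) * ENNReal.ofReal
    ((Set.Ioc M (max M (ρ + d))).indicator (fun y : ℝ => y ^ (-(d : ℝ))) ‖x‖) with hg
  have hfar (k : stdLattice d) : truncKernel (d : ℝ) ρ (k : EuclideanSpace ℝ (Fin d)) ≤
      T.indicator (fun k : stdLattice d =>
          ENNReal.ofReal (‖(k : EuclideanSpace ℝ (Fin d))‖ ^ (-(d : ℝ)))) k
        + ∫⁻ x in unitCell d, g (k + x) := by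
    by_cases hk : k ∈ T
    · rw [Set.indicator_of_mem hk]
      exact (truncKernel_le _ _ _).trans le_self_add
    rw [Set.indicator_of_notMem hk, zero_add]
    have hk' : M + d < ‖(k : EuclideanSpace ℝ (Fin d))‖ := by simpa [T] using hk
    unfold truncKernel
    split_ifs with hk2
    swap
    · exact zero_le
    calc ENNReal.ofReal (‖(k : EuclideanSpace ℝ (Fin d))‖ ^ (-(d : ℝ)))
        = ∫⁻ x in unitCell d, ENNReal.ofReal (‖(k : EuclideanSpace ℝ (Fin d))‖ ^ (-(d : ℝ))) := by
          simp [volume_unitCell]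
      _ ≤ _ := setLIntegral_mono' measurableSet_unitCell fun x hx => ?_
    have hx := norm_le_of_mem_unitCell hx
    have h1 : ‖(k : EuclideanSpace ℝ (Fin d)) + x‖ ≤ ‖(k : EuclideanSpace ℝ (Fin d))‖ + d :=
      (norm_add_le _ _).trans (by linarith)
    have h2 : ‖(k : EuclideanSpace ℝ (Fin d))‖ - d ≤ ‖(k : EuclideanSpace ℝ (Fin d)) + x‖ := by
      have := norm_sub_le ((k : EuclideanSpace ℝ (Fin d)) + x) x
      rw [add_sub_cancel_right] at this
      linarith
    have hmem : ‖(k : EuclideanSpace ℝ (Fin d)) + x‖ ∈ Set.Ioc M (max M (ρ + d)) :=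
      ⟨by linarith, le_max_of_le_right (by linarith [hk2.2])⟩
    simp only [hg]
    rw [Set.indicator_of_mem hmem, ← ENNReal.ofReal_mul (by linarith)]
    refine ENNReal.ofReal_le_ofReal ((Real.rpow_le_rpow_of_nonpos ?_ ?_ ?_).trans (hM _ hmem.1.le))
    · linarith [hmem.1]
    · linarith
    · linarith
  calc _ ≤ ∑' k : stdLattice d, _ := ENNReal.tsum_le_tsum hfar
    _ = ENNReal.ofReal K₀ + ∫⁻ x, g x := by
      rw [ENNReal.tsum_add, ← lintegral_eq_tsum_unitCell]
      congr 1
      rw [ENNReal.ofReal_sum_of_nonneg fun _ _ => by positivity, tsum_eq_sum (s := hT.toFinset)]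
      · exact Finset.sum_congr rfl fun k hk => Set.indicator_of_mem (hT.mem_toFinset.1 hk) _
      · exact fun k hk => Set.indicator_of_notMem (fun h => hk (hT.mem_toFinset.2 h)) _
    _ = ENNReal.ofReal K₀ + ENNReal.ofReal ((1 + ε) * (d * v * Real.log (max M (ρ + d) / M))) := by
      simp only [hg]
      rw [lintegral_const_mul' _ _ ENNReal.ofReal_ne_top,
        lintegral_norm_rpow_shell hd hM0 (le_max_left _ _), ← ENNReal.ofReal_mul (by linarith)]
    _ ≤ _ := by
      have hlog0 : 0 ≤ Real.log (max M (ρ + d) / M) :=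
        Real.log_nonneg ((one_le_div hM0).2 (le_max_left _ _))
      rw [← ENNReal.ofReal_add hK₀ (by positivity)]
      refine ENNReal.ofReal_le_ofReal ?_
      have h3 : Real.log (max M (ρ + d) / M) ≤ Real.log ρ + Real.log (1 + d) + |Real.log M| := by
        have hρ0 : 0 ≤ Real.log ρ := Real.log_nonneg hρ
        have hd0 : 0 ≤ Real.log (1 + d) := Real.log_nonneg (by linarith)
        rcases max_cases M (ρ + d) with ⟨h, _⟩ | ⟨h, _⟩ <;> rw [h]
        · rw [div_self hM0.ne', Real.log_one]; positivity
        · rw [Real.log_div (by positivity) hM0.ne', ← Real.log_mul (by positivity) (by positivity)]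
          have : Real.log (ρ + d) ≤ Real.log (ρ * (1 + d)) :=
            Real.log_le_log (by positivity) (by nlinarith)
          linarith [neg_abs_le (Real.log M)]
      have h4 : 0 ≤ (1 + ε) * (d * v) := by positivity
      nlinarith [mul_le_mul_of_nonneg_left h3 h4]

end Lattice

/-! ### Intersecting a set with random translates of a periodic configuration -/

section Averaging

variable {d : ℕ}

/-- The potential at `f` of the periodic configuration `F + ℤ^d`, with truncated kernel. -/
def latticePotential (s R : ℝ) (F : Finset (EuclideanSpace ℝ (Fin d)))
    (f : EuclideanSpace ℝ (Fin d)) : ℝ≥0∞ :=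
  ∑ f' ∈ F, ∑' k : stdLattice d, truncKernel s R (f - f' - (k : EuclideanSpace ℝ (Fin d)))

/-- The number of lattice translates of `v` that lie in `A`. -/
def latticeCount (A : Set (EuclideanSpace ℝ (Fin d))) (v : EuclideanSpace ℝ (Fin d)) : ℝ≥0∞ :=
  ∑' k : stdLattice d, A.indicator (1 : EuclideanSpace ℝ (Fin d) → ℝ≥0∞) (k + v)

lemma measurable_latticeCount {A : Set (EuclideanSpace ℝ (Fin d))} (hA : MeasurableSet A) :
    Measurable (latticeCount A) := by
  have hm : Measurable (A.indicator (1 : EuclideanSpace ℝ (Fin d) → ℝ≥0∞)) :=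
    measurable_one.indicator hA
  refine Measurable.tsum fun k => hm.comp ?_
  fun_prop

lemma setLIntegral_latticeCount {A : Set (EuclideanSpace ℝ (Fin d))} (hA : MeasurableSet A)
    (v : EuclideanSpace ℝ (Fin d)) :
    ∫⁻ t in unitCell d, latticeCount A (t + v) = volume A := by
  rw [← lintegral_tsum_indicator hA v]
  simp only [latticeCount, add_assoc]

/-- Each counted `k` contributes a whole unit cell within `3 * d` of `A`, since three vectors of
norm at most `d` are involved, and these cells are disjoint. This uniform bound is what prevents the
counts from fluctuating far above their mean. -/
lemma latticeCount_le {A : Set (EuclideanSpace ℝ (Fin d))} {t f : EuclideanSpace ℝ (Fin d)}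
    (ht : t ∈ unitCell d) (hf : f ∈ unitCell d) :
    latticeCount A (t + f) ≤ volume (Metric.cthickening (3 * d) A) := by
  refine tsum_indicator_le_volume _ (fun k hk x hx => ?_) Metric.isClosed_cthickening.measurableSet
  refine Metric.mem_cthickening_of_dist_le _ _ _ _ hk ?_
  rw [dist_eq_norm, add_sub_add_left_eq_sub]
  have := norm_sub_le x (t + f)
  have := norm_add_le t f
  linarith [norm_le_of_mem_unitCell ht, norm_le_of_mem_unitCell hf, norm_le_of_mem_unitCell hx]

lemma unitCell_add_injective {f f' t : EuclideanSpace ℝ (Fin d)} (hf : f ∈ unitCell d)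
    (hf' : f' ∈ unitCell d) {k k' : stdLattice d}
    (h : (k : EuclideanSpace ℝ (Fin d)) + (t + f) = k' + (t + f')) : f = f' ∧ k = k' := by
  have h1 : f = f' := by
    rw [← ZSpan.fract_eq_self.2 hf, ← ZSpan.fract_eq_self.2 hf', ZSpan.fract_eq_fract]
    have : -f + f' = ((k - k' : stdLattice d) : EuclideanSpace ℝ (Fin d)) := by
      rw [Submodule.coe_sub, sub_eq_of_eq_add]
      have h2 : (k : EuclideanSpace ℝ (Fin d)) = k' + (t + f') - (t + f) := eq_sub_of_add_eq h
      rw [h2]; abel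
    rw [this]
    exact Subtype.mem _
  subst h1
  exact ⟨rfl, Subtype.ext (add_right_cancel h)⟩

/-- The configuration is `A ∩ (t + F + ℤ^d)`. Its points are at mutual distance at most `R`, so
truncating the kernel loses nothing, and extending the sum from `A` to the full periodic
configuration only increases it. -/
lemma exists_finset_translate {A : Set (EuclideanSpace ℝ (Fin d))} {R : ℝ} (s : ℝ)
    (hR : ∀ x ∈ A, ∀ y ∈ A, dist x y ≤ R) {F : Finset (EuclideanSpace ℝ (Fin d))}
    (hF : (F : Set (EuclideanSpace ℝ (Fin d))) ⊆ unitCell d) (t : EuclideanSpace ℝ (Fin d)) :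
    ∃ ω : Finset (EuclideanSpace ℝ (Fin d)), (ω : Set (EuclideanSpace ℝ (Fin d))) ⊆ A ∧
      (ω.card : ℝ≥0∞) = ∑ f ∈ F, latticeCount A (t + f) ∧
      ENNReal.ofReal (rieszEnergy s ω) ≤
        ∑ f ∈ F, latticeCount A (t + f) * latticePotential s R F f := by
  classical
  have hAb : Bornology.IsBounded A := Metric.isBounded_iff.2 ⟨R, fun x hx y hy => hR x hx y hy⟩
  have hfin (f : EuclideanSpace ℝ (Fin d)) : {k : stdLattice d | ↑k + (t + f) ∈ A}.Finite := by
    have hb : Bornology.IsBounded ((fun x => x + (t + f)) ⁻¹' A) := by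
      refine Metric.isBounded_iff.2 ⟨R, fun x hx y hy => ?_⟩
      simpa using hR _ hx _ hy
    refine ((ZSpan.setFinite_inter (stdBasis d) hb).preimage
      (f := fun k : stdLattice d => (k : EuclideanSpace ℝ (Fin d)))
      Subtype.val_injective.injOn).subset fun k hk => ⟨hk, k.2⟩
  set T : EuclideanSpace ℝ (Fin d) → Finset (stdLattice d) := fun f => (hfin f).toFinset with hT
  have hTmem (f k) : k ∈ T f ↔ (k : EuclideanSpace ℝ (Fin d)) + (t + f) ∈ A := by simp [hT]
  have hcount (f) : latticeCount A (t + f) = (T f).card := by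
    rw [latticeCount, tsum_eq_sum (s := T f)]
    · rw [Finset.sum_congr rfl fun k hk => Set.indicator_of_mem ((hTmem f k).1 hk) _]
      simp
    · exact fun k hk => Set.indicator_of_notMem (fun h => hk ((hTmem f k).2 h)) _
  set J : Finset (Σ _ : EuclideanSpace ℝ (Fin d), stdLattice d) := F.sigma T with hJ
  set φ : (Σ _ : EuclideanSpace ℝ (Fin d), stdLattice d) → EuclideanSpace ℝ (Fin d) :=
    fun p => p.2 + (t + p.1) with hφ
  have hinj : Set.InjOn φ J := by
    rintro ⟨f, k⟩ hp ⟨f', k'⟩ hq h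
    have hp := Finset.mem_sigma.1 (Finset.mem_coe.1 hp)
    have hq := Finset.mem_sigma.1 (Finset.mem_coe.1 hq)
    obtain ⟨rfl, rfl⟩ := unitCell_add_injective (hF hp.1) (hF hq.1) h
    rfl
  have hsub : ((J.image φ : Finset _) : Set (EuclideanSpace ℝ (Fin d))) ⊆ A := by
    intro x hx
    obtain ⟨p, hp, rfl⟩ := Finset.mem_image.1 (Finset.mem_coe.1 hx)
    exact (hTmem _ _).1 (Finset.mem_sigma.1 hp).2
  refine ⟨J.image φ, hsub, ?_, ?_⟩
  · rw [Finset.card_image_of_injOn hinj, hJ, Finset.card_sigma, Nat.cast_sum]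
    exact Finset.sum_congr rfl fun f _ => (hcount f).symm
  have hterm (y) (hy : y ∈ J.image φ) :
      ENNReal.ofReal (∑ x ∈ (J.image φ).erase y, 1 / dist x y ^ s) ≤
        ∑ q ∈ J, truncKernel s R (y - φ q) := by
    rw [← Finset.sum_image (f := fun x => truncKernel s R (y - x)) hinj,
      ENNReal.ofReal_sum_of_nonneg fun _ _ => by positivity]
    refine le_trans (Finset.sum_le_sum fun x hx => ?_)
      (Finset.sum_le_sum_of_subset (Finset.erase_subset y _))
    have hxy : y - x ≠ 0 := sub_ne_zero.2 (Finset.ne_of_mem_erase hx).symm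
    have hle : ‖y - x‖ ≤ R := by
      rw [← dist_eq_norm]
      exact hR _ (hsub hy) _ (hsub (Finset.mem_of_mem_erase hx))
    rw [truncKernel, if_pos ⟨hxy, hle⟩, dist_comm, dist_eq_norm, Real.rpow_neg (norm_nonneg _),
      one_div]
  rw [rieszEnergy_eq, ENNReal.ofReal_sum_of_nonneg
    fun _ _ => Finset.sum_nonneg fun _ _ => by positivity]
  refine (Finset.sum_le_sum hterm).trans ?_
  rw [Finset.sum_image hinj, hJ, Finset.sum_sigma]
  refine Finset.sum_le_sum fun f _ => ?_
  rw [hcount, ← nsmul_eq_mul]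
  refine Finset.sum_le_card_nsmul _ _ _ fun k _ => ?_
  rw [Finset.sum_sigma, latticePotential]
  refine Finset.sum_le_sum fun f' _ => ?_
  refine (ENNReal.sum_le_tsum _).trans ?_
  -- Periodicity: the potential at `k + t + f` is the potential at `f`, after shifting the summation
  -- index by `k`.
  rw [← (Equiv.subRight k).tsum_eq (fun k' : stdLattice d => truncKernel s R
    (f - f' - (k' : EuclideanSpace ℝ (Fin d))))]
  refine ENNReal.tsum_le_tsum fun k' => le_of_eq ?_
  congr 1
  simp only [hφ, Equiv.subRight_apply, Submodule.coe_sub]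
  abel

/-- First-moment method for two requirements at once. The deficits `(1 + ε ^ 2) * a - n f t` are
nonnegative with mean `ε ^ 2 * a`, so their sum can be added, suitably weighted, to the energy bound
and a single translate chosen for the total. -/
lemma minRieszEnergy_le_of_periodic {A : Set (EuclideanSpace ℝ (Fin d))} (hA : MeasurableSet A)
    {R : ℝ} (s : ℝ) (hR : ∀ x ∈ A, ∀ y ∈ A, dist x y ≤ R)
    {F : Finset (EuclideanSpace ℝ (Fin d))}
    (hF : (F : Set (EuclideanSpace ℝ (Fin d))) ⊆ unitCell d) (hne : F.Nonempty)
    {a ε e : ℝ} (ha : 0 < a) (hvol : volume A = ENNReal.ofReal a) (hε : 0 < ε)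
    (hthick : volume (Metric.cthickening (3 * d) A) ≤ ENNReal.ofReal ((1 + ε ^ 2) * a))
    (he0 : 0 < e) (he : ∑ f ∈ F, latticePotential s R F f ≤ ENNReal.ofReal e) {m : ℕ}
    (hm : (m : ℝ) ≤ (1 - ε) * F.card * a) :
    minRieszEnergy s A m ≤ ENNReal.ofReal ((1 + ε) * a * e) := by
  set n : EuclideanSpace ℝ (Fin d) → EuclideanSpace ℝ (Fin d) → ℝ :=
    fun f t => (latticeCount A (t + f)).toReal with hn
  set V : EuclideanSpace ℝ (Fin d) → ℝ := fun f => (latticePotential s R F f).toReal with hV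
  have hcard : (0 : ℝ) < F.card := by exact_mod_cast hne.card_pos
  have hVtop (f) (hf : f ∈ F) : latticePotential s R F f ≠ ∞ :=
    (lt_of_le_of_lt ((Finset.single_le_sum (f := latticePotential s R F)
      (fun _ _ => zero_le) hf).trans he)
      ENNReal.ofReal_lt_top).ne
  have hVsum : ∑ f ∈ F, V f ≤ e := by
    rw [hV, ← ENNReal.toReal_sum hVtop]
    exact ENNReal.toReal_le_of_le_ofReal he0.le he
  have hctop (f) (hf : f ∈ F) (t) (ht : t ∈ unitCell d) : latticeCount A (t + f) ≠ ∞ :=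
    (lt_of_le_of_lt ((latticeCount_le ht (hF hf)).trans hthick) ENNReal.ofReal_lt_top).ne
  have hnle (f) (hf : f ∈ F) (t) (ht : t ∈ unitCell d) : n f t ≤ (1 + ε ^ 2) * a :=
    ENNReal.toReal_le_of_le_ofReal (by positivity) ((latticeCount_le ht (hF hf)).trans hthick)
  have hmeas (f) : Measurable fun t => latticeCount A (t + f) :=
    (measurable_latticeCount hA).comp (by fun_prop)
  have hnint (f) : IntegrableOn (n f) (unitCell d) :=
    integrable_toReal_of_lintegral_ne_top (hmeas f).aemeasurable
      (by rw [setLIntegral_latticeCount hA, hvol]; exact ENNReal.ofReal_ne_top)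
  have hnI (f) (hf : f ∈ F) : ∫ t in unitCell d, n f t = a := by
    rw [hn, integral_toReal (hmeas f).aemeasurable, setLIntegral_latticeCount hA, hvol,
      ENNReal.toReal_ofReal ha.le]
    exact (ae_restrict_mem measurableSet_unitCell).mono fun t ht => (hctop f hf t ht).lt_top
  -- The energy part has mean at most `1` and the deficit part has mean `ε`. If `W t ≤ 1 + ε`, each
  -- part is at most `1 + ε`; the deficit then leaves at least `(1 + ε²) - ε (1 + ε) = 1 - ε` times
  -- `|F| a` points.
  set W : EuclideanSpace ℝ (Fin d) → ℝ := fun t =>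
    ∑ f ∈ F, (V f / (e * a) * n f t + (ε * F.card * a)⁻¹ * ((1 + ε ^ 2) * a - n f t)) with hW
  have hconst : IntegrableOn (fun _ : EuclideanSpace ℝ (Fin d) => (1 + ε ^ 2) * a) (unitCell d) :=
    integrableOn_const (by simp [volume_unitCell])
  have hdiff (f) : IntegrableOn (fun t => (1 + ε ^ 2) * a - n f t) (unitCell d) :=
    hconst.sub (hnint f)
  have hterm (f) : IntegrableOn
      (fun t => V f / (e * a) * n f t + (ε * F.card * a)⁻¹ * ((1 + ε ^ 2) * a - n f t))
      (unitCell d) :=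
    ((hnint f).const_mul _).add ((hdiff f).const_mul _)
  have hvolr : volume.real (unitCell d) = 1 := by simp [measureReal_def, volume_unitCell]
  have hWI : ∫ t in unitCell d, W t ≤ 1 + ε := by
    rw [hW, integral_finsetSum _ fun f _ => hterm f]
    have : ∀ f ∈ F, ∫ t in unitCell d,
        (V f / (e * a) * n f t + (ε * F.card * a)⁻¹ * ((1 + ε ^ 2) * a - n f t))
        = V f / e + ε / F.card := by
      intro f hf
      rw [integral_add ((hnint f).const_mul _) ((hdiff f).const_mul _),
        integral_const_mul, integral_const_mul, integral_sub hconst (hnint f), hnI f hf,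
        setIntegral_const, hvolr]
      simp only [smul_eq_mul]
      field_simp
      ring
    rw [Finset.sum_congr rfl this, Finset.sum_add_distrib, ← Finset.sum_div, Finset.sum_const,
      nsmul_eq_mul, mul_div_cancel₀ _ hcard.ne']
    gcongr
    exact (div_le_one he0).2 hVsum
  obtain ⟨t, ht, hWt⟩ : ∃ t ∈ unitCell d, W t ≤ 1 + ε := by
    obtain ⟨t, ht, h⟩ := exists_le_setAverage (μ := volume) (s := unitCell d) (f := W)
      (by simp [volume_unitCell]) (by simp [volume_unitCell])
      (integrable_finsetSum _ fun f _ => hterm f)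
    rw [setAverage_eq, hvolr, inv_one, one_smul] at h
    exact ⟨t, ht, h.trans hWI⟩
  obtain ⟨ω, hωA, hωcard, hωE⟩ := exists_finset_translate s hR hF t
  have hn0 (f) : 0 ≤ n f t := ENNReal.toReal_nonneg
  have hV0 (f) : 0 ≤ V f := ENNReal.toReal_nonneg
  have hU0 : 0 ≤ ∑ f ∈ F, n f t * V f := Finset.sum_nonneg fun f _ => mul_nonneg (hn0 f) (hV0 f)
  have hZ0 : 0 ≤ ∑ f ∈ F, ((1 + ε ^ 2) * a - n f t) :=
    Finset.sum_nonneg fun f hf => sub_nonneg.2 (hnle f hf t ht)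
  have hWeq : W t = (∑ f ∈ F, n f t * V f) / (e * a)
      + (∑ f ∈ F, ((1 + ε ^ 2) * a - n f t)) / (ε * F.card * a) := by
    rw [hW, Finset.sum_div, Finset.sum_div, ← Finset.sum_add_distrib]
    refine Finset.sum_congr rfl fun f _ => ?_
    field_simp
  have hU : ∑ f ∈ F, n f t * V f ≤ (1 + ε) * a * e := by
    have : (∑ f ∈ F, n f t * V f) / (e * a) ≤ 1 + ε := by
      have : 0 ≤ (∑ f ∈ F, ((1 + ε ^ 2) * a - n f t)) / (ε * F.card * a) := by positivity
      linarith
    rw [div_le_iff₀ (by positivity)] at this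
    linarith
  have hZ : ∑ f ∈ F, ((1 + ε ^ 2) * a - n f t) ≤ (1 + ε) * (ε * F.card * a) := by
    have : (∑ f ∈ F, ((1 + ε ^ 2) * a - n f t)) / (ε * F.card * a) ≤ 1 + ε := by
      have : 0 ≤ (∑ f ∈ F, n f t * V f) / (e * a) := by positivity
      linarith
    rwa [div_le_iff₀ (by positivity)] at this
  have hωcard' : (ω.card : ℝ) = ∑ f ∈ F, n f t := by
    rw [hn, ← ENNReal.toReal_sum fun f hf => hctop f hf t ht, ← hωcard, ENNReal.toReal_natCast]
  refine (minRieszEnergy_le hωA ?_).trans (hωE.trans ?_)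
  · have : (m : ℝ) ≤ ω.card := by
      rw [Finset.sum_sub_distrib, Finset.sum_const, nsmul_eq_mul, ← hωcard'] at hZ
      have : 0 < F.card * a := by positivity
      nlinarith
    exact_mod_cast this
  · rw [ENNReal.le_ofReal_iff_toReal_le _ (by positivity)]
    · rw [ENNReal.toReal_sum]
      · simpa [hn, hV] using hU
      · exact fun f hf => ENNReal.mul_ne_top (hctop f hf t ht) (hVtop f hf)
    · exact ENNReal.sum_ne_top.2 fun f hf => ENNReal.mul_ne_top (hctop f hf t ht) (hVtop f hf)

end Averaging

/-! ### Upper bounds for the minimal energy of a compact set -/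

section Upper

variable {d : ℕ}

open scoped Pointwise in
lemma volume_inv_smul {h : ℝ} (hh : 0 < h) (S : Set (EuclideanSpace ℝ (Fin d))) :
    volume (h⁻¹ • S) = ENNReal.ofReal (h ^ (-(d : ℝ))) * volume S := by
  rw [Measure.addHaar_smul, finrank_euclideanSpace_fin, abs_of_pos (by positivity),
    Real.rpow_neg hh.le, Real.rpow_natCast, inv_pow]

open scoped Pointwise in
lemma cthickening_inv_smul_subset {h : ℝ} (hh : 0 < h) {r : ℝ}
    {A : Set (EuclideanSpace ℝ (Fin d))} (hA : IsCompact A) :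
    Metric.cthickening r (h⁻¹ • A) ⊆ h⁻¹ • Metric.cthickening (r * h) A := by
  intro x hx
  rcases lt_or_ge r 0 with hr | hr
  · rw [Metric.cthickening_of_nonpos hr.le, (hA.smul _).isClosed.closure_eq] at hx
    exact Set.smul_set_mono (Metric.self_subset_cthickening _) hx
  rw [(hA.smul _).cthickening_eq_biUnion_closedBall hr] at hx
  simp only [Set.mem_iUnion, Metric.mem_closedBall] at hx
  obtain ⟨_, ⟨y, hy, rfl⟩, hxy⟩ := hx
  rw [Set.mem_inv_smul_set_iff₀ hh.ne']
  refine Metric.mem_cthickening_of_dist_le _ y _ _ hy ?_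
  have : y = h • h⁻¹ • y := (smul_inv_smul₀ hh.ne' y).symm
  rw [this, dist_smul₀, Real.norm_of_nonneg hh.le, mul_comm]
  exact mul_le_mul_of_nonneg_right hxy hh.le

open scoped Pointwise in
-- Thickening `h⁻¹ • A` by `3 * d` amounts to thickening `A` by `3 * d * h`, and for compact `A`
-- this volume tends to that of `A`. The threshold `h₀` depends on neither `R` nor `e`, which may
-- therefore vary with `h`.
lemma exists_minRieszEnergy_le_of_scale {A : Set (EuclideanSpace ℝ (Fin d))} (hA : IsCompact A)
    {a : ℝ} (ha : 0 < a) (hvol : volume A = ENNReal.ofReal a)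
    {F : Finset (EuclideanSpace ℝ (Fin d))}
    (hF : (F : Set (EuclideanSpace ℝ (Fin d))) ⊆ unitCell d) (hne : F.Nonempty)
    {ε : ℝ} (hε : 0 < ε) :
    ∃ h₀ > 0, ∀ h, 0 < h → h < h₀ → ∀ s R e : ℝ, (∀ x ∈ A, ∀ y ∈ A, dist x y ≤ R * h) → 0 < e →
      ∑ f ∈ F, latticePotential s R F f ≤ ENNReal.ofReal e →
      ∀ m : ℕ, (m : ℝ) ≤ (1 - ε) * F.card * (h ^ (-(d : ℝ)) * a) →
      minRieszEnergy s A m ≤ ENNReal.ofReal (h ^ (-s) * ((1 + ε) * (h ^ (-(d : ℝ)) * a) * e)) := by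
  have hlim : Tendsto (fun h : ℝ => volume (Metric.cthickening (3 * d * h) A)) (𝓝 0)
      (𝓝 (volume A)) := by
    refine (tendsto_measure_cthickening_of_isCompact hA).comp ?_
    simpa using (continuous_const_mul (3 * (d : ℝ))).tendsto 0
  have hlt : volume A < ENNReal.ofReal ((1 + ε ^ 2) * a) := by
    rw [hvol, ENNReal.ofReal_lt_ofReal_iff (by positivity)]
    nlinarith [mul_pos (pow_pos hε 2) ha]
  obtain ⟨h₀, hh₀, hball⟩ := Metric.eventually_nhds_iff.1 (hlim.eventually (gt_mem_nhds hlt))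
  refine ⟨h₀, hh₀, fun h hh hhh₀ s R e hR he0 he m hm => ?_⟩
  have hhd : 0 < h ^ (-(d : ℝ)) := Real.rpow_pos_of_pos hh _
  have hthick : volume (Metric.cthickening (3 * d) (h⁻¹ • A)) ≤
      ENNReal.ofReal ((1 + ε ^ 2) * (h ^ (-(d : ℝ)) * a)) := by
    refine (measure_mono (cthickening_inv_smul_subset hh hA)).trans ?_
    rw [volume_inv_smul hh, mul_left_comm, ENNReal.ofReal_mul hhd.le]
    gcongr
    exact (hball (by rwa [dist_zero_right, Real.norm_of_nonneg hh.le])).le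
  have hvol' : volume (h⁻¹ • A) = ENNReal.ofReal (h ^ (-(d : ℝ)) * a) := by
    rw [volume_inv_smul hh, hvol, ENNReal.ofReal_mul hhd.le]
  have hR' : ∀ x ∈ h⁻¹ • A, ∀ y ∈ h⁻¹ • A, dist x y ≤ R := by
    rintro _ ⟨x, hx, rfl⟩ _ ⟨y, hy, rfl⟩
    simp only [dist_smul₀, norm_inv, Real.norm_of_nonneg hh.le]
    rw [inv_mul_le_iff₀ hh, mul_comm]
    exact hR x hx y hy
  have key := minRieszEnergy_le_of_periodic (hA.smul h⁻¹).measurableSet s hR' hF hne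
    (mul_pos hhd ha) hvol' hε hthick he0 he hm
  have := minRieszEnergy_image_le (s := s) hh (f := fun x : EuclideanSpace ℝ (Fin d) => h • x)
    (fun x y => by rw [dist_smul₀, Real.norm_of_nonneg hh.le]) (h⁻¹ • A) m key
  rwa [Set.image_smul, smul_inv_smul₀ hh.ne'] at this

/-- The scale is chosen so that `N` equals `(1 - ε) |F| h^(-d) a`. The quantifiers over `R` and `e`
stand inside `∀ᶠ` because in the critical case both grow with `N`. -/
lemma eventually_minRieszEnergy_le (hd : 1 ≤ d) {A : Set (EuclideanSpace ℝ (Fin d))}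
    (hA : IsCompact A) {a : ℝ} (ha : 0 < a) (hvol : volume A = ENNReal.ofReal a)
    {F : Finset (EuclideanSpace ℝ (Fin d))}
    (hF : (F : Set (EuclideanSpace ℝ (Fin d))) ⊆ unitCell d) (hne : F.Nonempty)
    {ε : ℝ} (hε : 0 < ε) (hε1 : ε < 1) :
    ∀ᶠ N : ℕ in atTop, ∀ s R e : ℝ,
      (∀ x ∈ A, ∀ y ∈ A, dist x y * (N / ((1 - ε) * F.card * a)) ^ (1 / (d : ℝ)) ≤ R) → 0 < e →
      ∑ f ∈ F, latticePotential s R F f ≤ ENNReal.ofReal e →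
      minRieszEnergy s A N ≤
        ENNReal.ofReal ((1 + ε) * a * e * (N / ((1 - ε) * F.card * a)) ^ (1 + s / d)) := by
  have hd0 : (0 : ℝ) < d := by exact_mod_cast hd
  have hcard : (0 : ℝ) < F.card := by exact_mod_cast hne.card_pos
  have hc : 0 < (1 - ε) * F.card * a := by have : 0 < 1 - ε := by linarith
                                           positivity
  obtain ⟨h₀, hh₀, H⟩ := exists_minRieszEnergy_le_of_scale hA ha hvol hF hne hε
  have hlim : Tendsto (fun N : ℕ => ((N : ℝ) / ((1 - ε) * F.card * a)) ^ (-(1 / (d : ℝ)))) atTop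
      (𝓝 0) :=
    (tendsto_rpow_neg_atTop (by positivity)).comp
      (tendsto_natCast_atTop_atTop.atTop_div_const hc)
  filter_upwards [hlim.eventually (gt_mem_nhds hh₀), eventually_gt_atTop 0]
    with N hN hN0 s R e hR he0 he
  have hN0' : (0 : ℝ) < N := by exact_mod_cast hN0
  set q : ℝ := N / ((1 - ε) * F.card * a) with hq
  have hq0 : 0 < q := by positivity
  have hpow (x : ℝ) : (q ^ (-(1 / (d : ℝ)))) ^ (-x) = q ^ (x / d) := by
    rw [← Real.rpow_mul hq0.le]
    congr 1
    field_simp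
  have key := H (q ^ (-(1 / (d : ℝ)))) (by positivity) hN s R e ?_ he0 he N ?_
  · convert key using 2
    rw [hpow, hpow, div_self hd0.ne', Real.rpow_one, Real.rpow_add hq0, Real.rpow_one]
    ring
  · intro x hx y hy
    have := hR x hx y hy
    rw [Real.rpow_neg hq0.le]
    rwa [← div_eq_mul_inv, le_div_iff₀ (by positivity)]
  · rw [hpow, div_self hd0.ne', Real.rpow_one, hq]
    have h1 : 1 - ε ≠ 0 := by linarith
    apply le_of_eq
    field_simp

lemma singleton_zero_subset_unitCell :
    (({0} : Finset (EuclideanSpace ℝ (Fin d))) : Set (EuclideanSpace ℝ (Fin d))) ⊆ unitCell d := by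
  simp

lemma latticePotential_singleton_zero (s R : ℝ) :
    ∑ f ∈ {(0 : EuclideanSpace ℝ (Fin d))}, latticePotential s R {0} f =
      ∑' k : stdLattice d, truncKernel s R (k : EuclideanSpace ℝ (Fin d)) := by
  simp [latticePotential, truncKernel]

lemma eventually_minRieszEnergy_div_le_log (hd : 1 ≤ d) {A : Set (EuclideanSpace ℝ (Fin d))}
    (hA : IsCompact A) {a : ℝ} (ha : 0 < a) (hvol : volume A = ENNReal.ofReal a) {c : ℝ}
    (hc : volume.real (Metric.ball (0 : EuclideanSpace ℝ (Fin d)) 1) / a < c) :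
    ∀ᶠ N : ℕ in atTop, minRieszEnergy (d : ℝ) A N / ENNReal.ofReal ((N : ℝ) ^ 2 * Real.log N)
      ≤ ENNReal.ofReal c := by
  set v := volume.real (Metric.ball (0 : EuclideanSpace ℝ (Fin d)) 1) with hv
  have hd0 : (0 : ℝ) < d := by exact_mod_cast hd
  have hv0 : 0 ≤ v := measureReal_nonneg
  obtain ⟨ε, hε, hε1, hεc⟩ : ∃ ε : ℝ, 0 < ε ∧ ε < 1 ∧
      (1 + ε) / (a * (1 - ε) ^ 2) * ((1 + ε) * (d * v) * (1 / d)) < c := by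
    have hcont : Tendsto (fun ε : ℝ => (1 + ε) / (a * (1 - ε) ^ 2) * ((1 + ε) * (d * v) * (1 / d)))
        (𝓝[>] 0) (𝓝 ((1 + 0) / (a * (1 - 0) ^ 2) * ((1 + 0) * (d * v) * (1 / d)))) := by
      refine Tendsto.mono_left ?_ nhdsWithin_le_nhds
      refine ContinuousAt.tendsto (f := fun ε : ℝ =>
        (1 + ε) / (a * (1 - ε) ^ 2) * ((1 + ε) * (d * v) * (1 / d))) ?_
      refine ContinuousAt.mul (ContinuousAt.div (by fun_prop) (by fun_prop) (by simp [ha.ne']))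
        (by fun_prop)
    have h0 : (1 + 0) / (a * (1 - 0) ^ 2) * ((1 + 0) * (d * v) * (1 / d)) < c := by
      convert hc using 1
      field_simp
      ring
    have h1 : ∀ᶠ ε : ℝ in 𝓝[>] 0, ε < 1 :=
      nhdsWithin_le_nhds (gt_mem_nhds one_pos)
    obtain ⟨ε, ⟨h2, h3⟩, h4⟩ :=
      ((hcont.eventually (gt_mem_nhds h0)).and h1 |>.and self_mem_nhdsWithin).exists
    exact ⟨ε, h4, h3, h2⟩
  obtain ⟨K, hK⟩ := exists_tsum_truncKernel_le hd hε
  have hb : 0 < (1 - ε) * a := mul_pos (by linarith) ha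
  set D : ℝ := Metric.diam A + 1 with hD
  have hD0 : 0 < D := by positivity
  set K' : ℝ := |K| + 1 + (1 + ε) * (d * v) * |Real.log (D / ((1 - ε) * a) ^ (1 / (d : ℝ)))|
  -- A bound for the diameter of the rescaled set. Its logarithm is `(1/d) log N + O(1)`, and the
  -- factor `1/d` cancels the `d` in the lattice sum.
  set R : ℕ → ℝ := fun N => D * (N / ((1 - ε) * a)) ^ (1 / (d : ℝ)) with hR
  have hRlim : Tendsto R atTop atTop :=
    ((tendsto_rpow_atTop (by positivity)).comp
      (tendsto_natCast_atTop_atTop.atTop_div_const hb)).const_mul_atTop hD0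
  have hlog : Tendsto (fun N : ℕ => Real.log N) atTop atTop :=
    Real.tendsto_log_atTop.comp tendsto_natCast_atTop_atTop
  have hfinal : Tendsto (fun N : ℕ => (1 + ε) / (a * (1 - ε) ^ 2) *
      ((1 + ε) * (d * v) * (1 / d) + K' * (Real.log N)⁻¹)) atTop
      (𝓝 ((1 + ε) / (a * (1 - ε) ^ 2) * ((1 + ε) * (d * v) * (1 / d) + K' * 0))) :=
    ((hlog.inv_tendsto_atTop.const_mul _).const_add _).const_mul _
  rw [mul_zero, add_zero] at hfinal
  filter_upwards [eventually_minRieszEnergy_le hd hA ha hvol singleton_zero_subset_unitCell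
    (Finset.singleton_nonempty _) hε hε1, hRlim.eventually_ge_atTop 1, hlog.eventually_gt_atTop 0,
    hfinal.eventually (gt_mem_nhds hεc), eventually_gt_atTop 0] with N hN hRN hlN hfN hN0
  have hN0' : (0 : ℝ) < N := by exact_mod_cast hN0
  simp only [Finset.card_singleton, Nat.cast_one, mul_one] at hN
  have hlogR : Real.log (R N) ≤ 1 / d * Real.log N
      + |Real.log (D / ((1 - ε) * a) ^ (1 / (d : ℝ)))| := by
    have : R N = (N : ℝ) ^ (1 / (d : ℝ)) * (D / ((1 - ε) * a) ^ (1 / (d : ℝ))) := by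
      simp only [hR]
      rw [Real.div_rpow hN0'.le hb.le]
      ring
    rw [this, Real.log_mul (by positivity) (by positivity), Real.log_rpow hN0']
    gcongr
    exact le_abs_self _
  have hvd : 0 ≤ (1 + ε) * (d * v) := by positivity
  set e : ℝ := (1 + ε) * (d * v) * (1 / d) * Real.log N + K' with he
  have hK'0 : 0 < K' := by positivity
  have he0 : 0 < e := by positivity
  have hpot : ∑ f ∈ {(0 : EuclideanSpace ℝ (Fin d))}, latticePotential d (R N) {0} f
      ≤ ENNReal.ofReal e := by
    rw [latticePotential_singleton_zero]
    refine (hK _ hRN).trans (ENNReal.ofReal_le_ofReal ?_)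
    have := mul_le_mul_of_nonneg_left hlogR hvd
    simp only [he, K']
    linarith [le_abs_self K]
  have hdist : ∀ x ∈ A, ∀ y ∈ A, dist x y * (N / ((1 - ε) * a)) ^ (1 / (d : ℝ)) ≤ R N := by
    intro x hx y hy
    simp only [hR]
    gcongr
    linarith [Metric.dist_le_diam_of_mem hA.isBounded hx hy]
  refine ENNReal.div_le_of_le_mul ?_
  have hc0 : 0 ≤ c := (div_nonneg hv0 ha.le).trans hc.le
  rw [← ENNReal.ofReal_mul hc0]
  refine (hN d (R N) e hdist he0 hpot).trans (ENNReal.ofReal_le_ofReal ?_)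
  have h2 : (1 : ℝ) + d / d = (2 : ℕ) := by rw [div_self hd0.ne']; norm_num
  rw [h2, Real.rpow_natCast]
  have h3 := mul_le_mul_of_nonneg_right hfN.le (show 0 ≤ (N : ℝ) ^ 2 * Real.log N by positivity)
  refine le_trans (le_of_eq ?_) h3
  have h4 : 1 - ε ≠ 0 := by linarith
  rw [he]
  field_simp

end Upper

/-! ### Lower bound in the critical case, by a Gaussian mixture -/

section Gaussian

variable {d : ℕ}

lemma integral_exp_neg_mul_sq_norm_sub {b : ℝ} (hb : 0 < b) (x : EuclideanSpace ℝ (Fin d)) :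
    ∫ z : EuclideanSpace ℝ (Fin d), Real.exp (-b * ‖z - x‖ ^ 2) = (Real.pi / b) ^ ((d : ℝ) / 2) := by
  rw [integral_sub_right_eq_self (fun z : EuclideanSpace ℝ (Fin d) => Real.exp (-b * ‖z‖ ^ 2)) x,
    GaussianFourier.integral_rexp_neg_mul_sq_norm hb, finrank_euclideanSpace_fin]

lemma integrable_exp_neg_mul_sq_norm_sub {b : ℝ} (hb : 0 < b) (x : EuclideanSpace ℝ (Fin d)) :
    Integrable fun z : EuclideanSpace ℝ (Fin d) => Real.exp (-b * ‖z - x‖ ^ 2) := by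
  -- A non-integrable function would have integral `0` by convention, whereas the known value is
  -- positive.
  by_contra h
  have h1 := integral_exp_neg_mul_sq_norm_sub hb x
  rw [integral_undef h] at h1
  have : 0 < (Real.pi / b) ^ ((d : ℝ) / 2) := Real.rpow_pos_of_pos (div_pos Real.pi_pos hb) _
  linarith

/-- The parallelogram law about the midpoint of `x` and `y`. Integrated over `z`, it makes the
Gaussian of parameter `t` a multiple of the self-convolution of the one of parameter `2 * t`. -/
lemma exp_mul_exp_eq (t : ℝ) (x y z : EuclideanSpace ℝ (Fin d)) :
    Real.exp (-(2 * t) * ‖z - x‖ ^ 2) * Real.exp (-(2 * t) * ‖z - y‖ ^ 2) =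
      Real.exp (-t * ‖x - y‖ ^ 2) * Real.exp (-(4 * t) * ‖z - (2⁻¹ : ℝ) • (x + y)‖ ^ 2) := by
  rw [← Real.exp_add, ← Real.exp_add]
  congr 1
  have h := parallelogram_law_with_norm ℝ (z - (2⁻¹ : ℝ) • (x + y)) ((2⁻¹ : ℝ) • (x - y))
  have h1 : z - (2⁻¹ : ℝ) • (x + y) + (2⁻¹ : ℝ) • (x - y) = z - y := by module
  have h2 : z - (2⁻¹ : ℝ) • (x + y) - (2⁻¹ : ℝ) • (x - y) = z - x := by module
  rw [h1, h2, norm_smul (2⁻¹ : ℝ) (x - y), Real.norm_of_nonneg (by norm_num)] at h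
  linear_combination (-2 * t) * h

/-- Outside the ball, half of the exponent is at least `t * r ^ 2`, and the other half is still
integrable. -/
lemma integral_ball_exp_ge {t r : ℝ} (ht : 0 < t) (hr : 0 < r) (x : EuclideanSpace ℝ (Fin d)) :
    (Real.pi / (2 * t)) ^ ((d : ℝ) / 2) - Real.exp (-t * r ^ 2) * (Real.pi / t) ^ ((d : ℝ) / 2) ≤
      ∫ z in Metric.ball x r, Real.exp (-(2 * t) * ‖z - x‖ ^ 2) := by
  have h2t : 0 < 2 * t := by positivity
  have hi := integrable_exp_neg_mul_sq_norm_sub h2t x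
  have hi' := integrable_exp_neg_mul_sq_norm_sub ht x
  have hsplit := integral_add_compl (Metric.isOpen_ball (x := x) (ε := r)).measurableSet hi
  rw [integral_exp_neg_mul_sq_norm_sub h2t x] at hsplit
  have htail : ∫ z in (Metric.ball x r)ᶜ, Real.exp (-(2 * t) * ‖z - x‖ ^ 2) ≤
      Real.exp (-t * r ^ 2) * (Real.pi / t) ^ ((d : ℝ) / 2) := by
    rw [← integral_exp_neg_mul_sq_norm_sub ht x, ← integral_const_mul]
    refine (setIntegral_mono_on hi.integrableOn (hi'.const_mul _).integrableOn
      Metric.isOpen_ball.measurableSet.compl fun z hz => ?_).trans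
      (setIntegral_le_integral (hi'.const_mul _) (ae_of_all _ fun z => by positivity))
    rw [← Real.exp_add, Real.exp_le_exp]
    have hz : r ≤ ‖z - x‖ := by simpa [dist_eq_norm] using hz
    have : r ^ 2 ≤ ‖z - x‖ ^ 2 := pow_le_pow_left₀ hr.le hz 2
    nlinarith
  linarith

/-- The double sum is proportional to the squared `L²` norm of a sum of Gaussians. All but a
fraction `δ` of its mass lies in `S`, so Cauchy–Schwarz bounds that norm below by mass squared over
`b`. -/
lemma sum_sum_exp_ge {ω : Finset (EuclideanSpace ℝ (Fin d))} {S : Set (EuclideanSpace ℝ (Fin d))}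
    {b : ℝ} (hb : 0 < b) (hvol : volume S ≤ ENNReal.ofReal b) {r : ℝ}
    (hr : 0 < r) (hball : ∀ x ∈ ω, Metric.ball x r ⊆ S) {t δ : ℝ} (ht : 0 < t) (hδ : δ ≤ 1)
    (hδt : (2 : ℝ) ^ ((d : ℝ) / 2) * Real.exp (-t * r ^ 2) ≤ δ) :
    (ω.card : ℝ) ^ 2 * (1 - δ) ^ 2 * (Real.pi / t) ^ ((d : ℝ) / 2) / b ≤
      ∑ x ∈ ω, ∑ y ∈ ω, Real.exp (-t * ‖x - y‖ ^ 2) := by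
  have h2t : 0 < 2 * t := by positivity
  set P : ℝ := (Real.pi / t) ^ ((d : ℝ) / 2) with hP
  set u : ℝ := (2 : ℝ) ^ ((d : ℝ) / 2) with hu
  have hP0 : 0 < P := Real.rpow_pos_of_pos (div_pos Real.pi_pos ht) _
  have hu0 : 0 < u := Real.rpow_pos_of_pos two_pos _
  have hP2 : (Real.pi / (2 * t)) ^ ((d : ℝ) / 2) = P / u := by
    rw [hP, hu, ← Real.div_rpow (by positivity) (by positivity), div_div, mul_comm t]
  have hP4 : (Real.pi / (4 * t)) ^ ((d : ℝ) / 2) = P / (u * u) := by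
    rw [hP, hu, ← Real.mul_rpow (by positivity) (by positivity),
      ← Real.div_rpow (by positivity) (by positivity), div_div, mul_comm t]
    norm_num
  set g : EuclideanSpace ℝ (Fin d) → EuclideanSpace ℝ (Fin d) → ℝ :=
    fun x z => Real.exp (-(2 * t) * ‖z - x‖ ^ 2) with hg
  have hgi (x) : Integrable (g x) := integrable_exp_neg_mul_sq_norm_sub h2t x
  have hggi (x y) : Integrable fun z => g x z * g y z := by
    simp only [hg, exp_mul_exp_eq]
    exact (integrable_exp_neg_mul_sq_norm_sub (by positivity) _).const_mul _
  have hgg (x y) : ∫ z, g x z * g y z = Real.exp (-t * ‖x - y‖ ^ 2) * (P / (u * u)) := by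
    simp only [hg, exp_mul_exp_eq]
    rw [integral_const_mul, integral_exp_neg_mul_sq_norm_sub (by positivity), hP4]
  have hG2 (z) : (∑ x ∈ ω, g x z) ^ 2 = ∑ x ∈ ω, ∑ y ∈ ω, g x z * g y z := by
    rw [sq, Finset.sum_mul_sum]
  have hGi : Integrable fun z => ∑ x ∈ ω, g x z := integrable_finsetSum _ fun x _ => hgi x
  have hG2i : Integrable fun z => (∑ x ∈ ω, g x z) ^ 2 := by
    simp only [hG2]
    exact integrable_finsetSum _ fun x _ => integrable_finsetSum _ fun y _ => hggi x y
  have hG2I : ∫ z, (∑ x ∈ ω, g x z) ^ 2 =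
      (∑ x ∈ ω, ∑ y ∈ ω, Real.exp (-t * ‖x - y‖ ^ 2)) * (P / (u * u)) := by
    simp only [hG2]
    rw [integral_finsetSum _ fun x _ => integrable_finsetSum _ fun y _ => hggi x y, Finset.sum_mul]
    refine Finset.sum_congr rfl fun x _ => ?_
    rw [integral_finsetSum _ fun y _ => hggi x y, Finset.sum_mul]
    exact Finset.sum_congr rfl fun y _ => hgg x y
  have hSfin : volume S ≠ ∞ := (hvol.trans_lt ENNReal.ofReal_lt_top).ne
  have hSb : volume.real S ≤ b := ENNReal.toReal_le_of_le_ofReal hb.le hvol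
  have hGS : ω.card * (P / u * (1 - δ)) ≤ ∫ z in S, ∑ x ∈ ω, g x z := by
    rw [integral_finsetSum _ fun x _ => (hgi x).integrableOn, ← nsmul_eq_mul]
    refine Finset.card_nsmul_le_sum _ _ _ fun x hx => ?_
    refine le_trans ?_ ((integral_ball_exp_ge ht hr x).trans
      (setIntegral_mono_set (hgi x).integrableOn (ae_of_all _ fun z => (Real.exp_pos _).le)
        (hball x hx).eventuallyLE))
    rw [hP2]
    have : P / u * (u * Real.exp (-t * r ^ 2)) ≤ P / u * δ :=
      mul_le_mul_of_nonneg_left hδt (by positivity)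
    have h2 : P / u * (u * Real.exp (-t * r ^ 2)) = Real.exp (-t * r ^ 2) * P := by
      field_simp
    linarith
  set I : ℝ := ω.card * (P / u * (1 - δ)) with hI
  have hI0 : 0 ≤ I := by
    have : 0 ≤ 1 - δ := by linarith
    positivity
  have hCS : I ^ 2 / b ≤ ∫ z, (∑ x ∈ ω, g x z) ^ 2 := by
    refine le_trans ?_ (setIntegral_le_integral (s := S) hG2i (ae_of_all _ fun z => sq_nonneg _))
    -- Cauchy–Schwarz in tangent-line form, `G² ≥ 2λG - λ²`, with `λ = I / b`, the value maximizing
    -- `2λI - bλ²`.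
    have hlow : ∫ z in S, (2 * (I / b) * (∑ x ∈ ω, g x z) - (I / b) ^ 2) ≤
        ∫ z in S, (∑ x ∈ ω, g x z) ^ 2 := by
      refine integral_mono ((hGi.integrableOn.const_mul _).sub (integrableOn_const hSfin))
        hG2i.integrableOn fun z => ?_
      simp only
      nlinarith [sq_nonneg (∑ x ∈ ω, g x z - I / b)]
    refine le_trans ?_ hlow
    rw [integral_sub (hGi.integrableOn.const_mul _) (integrableOn_const hSfin), integral_const_mul,
      setIntegral_const, smul_eq_mul]
    have h1 : 2 * (I / b) * I ≤ 2 * (I / b) * ∫ z in S, ∑ x ∈ ω, g x z :=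
      mul_le_mul_of_nonneg_left hGS (by positivity)
    have h2 : volume.real S * (I / b) ^ 2 ≤ b * (I / b) ^ 2 :=
      mul_le_mul_of_nonneg_right hSb (by positivity)
    have h3 : I ^ 2 / b = 2 * (I / b) * I - b * (I / b) ^ 2 := by
      field_simp
      ring
    linarith
  rw [hG2I, hI] at hCS
  have hfac : 0 < P / (u * u) := by positivity
  refine le_of_mul_le_mul_right (le_trans (le_of_eq ?_) hCS) hfac
  field_simp

lemma integral_rpow_mul_exp_eq {x : EuclideanSpace ℝ (Fin d)} (hd : 1 ≤ d) (hx : x ≠ 0) :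
    ∫ t in Set.Ioi (0 : ℝ), t ^ ((d : ℝ) / 2 - 1) * Real.exp (-t * ‖x‖ ^ 2) =
      Real.Gamma ((d : ℝ) / 2) * (1 / ‖x‖ ^ (d : ℝ)) := by
  have hd0 : (0 : ℝ) < d := by exact_mod_cast hd
  have hx0 : 0 < ‖x‖ := norm_pos_iff.2 hx
  have h := Real.integral_rpow_mul_exp_neg_mul_Ioi (a := (d : ℝ) / 2) (r := ‖x‖ ^ 2)
    (by positivity) (by positivity)
  have h1 : (1 / ‖x‖ ^ 2) ^ ((d : ℝ) / 2) = 1 / ‖x‖ ^ (d : ℝ) := by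
    rw [Real.div_rpow zero_le_one (by positivity), Real.one_rpow, ← Real.rpow_natCast,
      ← Real.rpow_mul hx0.le]
    congr 2
    push_cast
    ring
  rw [h1, mul_comm] at h
  rw [← h]
  refine setIntegral_congr_fun measurableSet_Ioi fun t _ => ?_
  congr 2
  ring

/-- The Gaussian representation of the kernel is cut down to `T < t ≤ T'`. The first term integrates
the Gaussian bound, which is a constant times `1/t`; the second is the price of removing the
diagonal pairs. -/
lemma rieszEnergy_ge_log (hd : 1 ≤ d) {ω : Finset (EuclideanSpace ℝ (Fin d))}
    {S : Set (EuclideanSpace ℝ (Fin d))}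
    {b : ℝ} (hb : 0 < b) (hvol : volume S ≤ ENNReal.ofReal b) {r : ℝ}
    (hr : 0 < r) (hball : ∀ x ∈ ω, Metric.ball x r ⊆ S) {T T' δ : ℝ} (hT : 0 < T) (hTT' : T ≤ T')
    (hδ : δ ≤ 1) (hδT : (2 : ℝ) ^ ((d : ℝ) / 2) * Real.exp (-T * r ^ 2) ≤ δ) :
    (ω.card : ℝ) ^ 2 * ((1 - δ) ^ 2 * Real.pi ^ ((d : ℝ) / 2) / b) * Real.log (T' / T)
      - ω.card * (T' ^ ((d : ℝ) / 2) * (2 / d)) ≤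
      Real.Gamma ((d : ℝ) / 2) * rieszEnergy (d : ℝ) ω := by
  classical
  have hd0 : (0 : ℝ) < d := by exact_mod_cast hd
  have hT'0 : 0 < T' := hT.trans_le hTT'
  set κ : ℝ := (1 - δ) ^ 2 * Real.pi ^ ((d : ℝ) / 2) / b with hκ
  set k : EuclideanSpace ℝ (Fin d) → ℝ → ℝ :=
    fun x t => t ^ ((d : ℝ) / 2 - 1) * Real.exp (-t * ‖x‖ ^ 2) with hk
  have hΓ : 0 < Real.Gamma ((d : ℝ) / 2) := Real.Gamma_pos_of_pos (by positivity)
  have hki (x : EuclideanSpace ℝ (Fin d)) (hx : x ≠ 0) : IntegrableOn (k x) (Set.Ioi 0) := by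
    by_contra h
    have h1 := integral_rpow_mul_exp_eq hd hx
    rw [integral_undef h] at h1
    have hx0 : 0 < ‖x‖ := norm_pos_iff.2 hx
    have : 0 < Real.Gamma ((d : ℝ) / 2) * (1 / ‖x‖ ^ (d : ℝ)) := by positivity
    linarith
  have hsub : Set.Ioc T T' ⊆ Set.Ioi (0 : ℝ) := fun t ht => hT.trans ht.1
  have hterm (x : EuclideanSpace ℝ (Fin d)) (hx : x ≠ 0) : ∫ t in Set.Ioc T T', k x t ≤
      Real.Gamma ((d : ℝ) / 2) * (1 / ‖x‖ ^ (d : ℝ)) := by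
    rw [← integral_rpow_mul_exp_eq hd hx]
    refine setIntegral_mono_set (hki x hx) ?_ hsub.eventuallyLE
    exact (ae_restrict_mem measurableSet_Ioi).mono fun t ht =>
      mul_nonneg (Real.rpow_nonneg (le_of_lt ht) _) (Real.exp_pos _).le
  have hne (y : EuclideanSpace ℝ (Fin d)) (x) (hx : x ∈ ω.erase y) : x - y ≠ 0 :=
    sub_ne_zero.2 (Finset.ne_of_mem_erase hx)
  have hupper : ∫ t in Set.Ioc T T', ∑ y ∈ ω, ∑ x ∈ ω.erase y, k (x - y) t ≤
      Real.Gamma ((d : ℝ) / 2) * rieszEnergy (d : ℝ) ω := by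
    rw [rieszEnergy_eq, Finset.mul_sum, integral_finsetSum]
    · refine Finset.sum_le_sum fun y _ => ?_
      rw [integral_finsetSum _ fun x hx => (hki _ (hne y x hx)).mono_set hsub, Finset.mul_sum]
      refine Finset.sum_le_sum fun x hx => ?_
      rw [dist_eq_norm]
      exact hterm _ (hne y x hx)
    · exact fun y _ => integrable_finsetSum _ fun x hx => (hki _ (hne y x hx)).mono_set hsub
  have hpos : ∀ t ∈ Set.uIcc T T', 0 < t := fun t ht => by
    rw [Set.uIcc_of_le hTT'] at ht
    exact hT.trans_le ht.1
  have hinv : IntervalIntegrable (fun t : ℝ => t⁻¹) volume T T' :=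
    intervalIntegral.intervalIntegrable_inv (fun t ht => (hpos t ht).ne') continuousOn_id
  have hrpow : IntervalIntegrable (fun t : ℝ => t ^ ((d : ℝ) / 2 - 1)) volume T T' :=
    intervalIntegral.intervalIntegrable_rpow' (by linarith [half_pos hd0])
  have hlower : ∫ t in Set.Ioc T T', ((ω.card : ℝ) ^ 2 * κ * t⁻¹ - ω.card * t ^ ((d : ℝ) / 2 - 1)) ≤
      ∫ t in Set.Ioc T T', ∑ y ∈ ω, ∑ x ∈ ω.erase y, k (x - y) t := by
    refine setIntegral_mono_on ?_ ?_ measurableSet_Ioc fun t ht => ?_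
    · exact ((hinv.const_mul _).sub (hrpow.const_mul _)).1
    · exact integrable_finsetSum _ fun y _ => integrable_finsetSum _ fun x hx =>
        (hki _ (hne y x hx)).mono_set hsub
    have ht0 : 0 < t := hT.trans ht.1
    have hδt : (2 : ℝ) ^ ((d : ℝ) / 2) * Real.exp (-t * r ^ 2) ≤ δ := by
      refine le_trans ?_ hδT
      gcongr
      exact ht.1.le
    have hmain := sum_sum_exp_ge hb hvol hr hball ht0 hδ hδt
    have hdiag : ∑ y ∈ ω, ∑ x ∈ ω.erase y, Real.exp (-t * ‖x - y‖ ^ 2) =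
        ∑ y ∈ ω, ∑ x ∈ ω, Real.exp (-t * ‖y - x‖ ^ 2) - ω.card := by
      have : ∀ y ∈ ω, ∑ x ∈ ω.erase y, Real.exp (-t * ‖x - y‖ ^ 2) =
          ∑ x ∈ ω, Real.exp (-t * ‖y - x‖ ^ 2) - 1 := by
        intro y hy
        rw [← Finset.sum_erase_add _ _ hy]
        simp [norm_sub_rev]
      rw [Finset.sum_congr rfl this, Finset.sum_sub_distrib]
      simp
    have hpow : t ^ ((d : ℝ) / 2 - 1) * (Real.pi / t) ^ ((d : ℝ) / 2) =
        Real.pi ^ ((d : ℝ) / 2) * t⁻¹ := by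
      rw [Real.div_rpow Real.pi_pos.le ht0.le, Real.rpow_sub_one ht0.ne']
      field_simp
    have htp : 0 < t ^ ((d : ℝ) / 2 - 1) := Real.rpow_pos_of_pos ht0 _
    simp only [hk, ← Finset.mul_sum]
    rw [hdiag]
    have := mul_le_mul_of_nonneg_left hmain htp.le
    have h2 : (ω.card : ℝ) ^ 2 * κ * t⁻¹ = t ^ ((d : ℝ) / 2 - 1) *
        ((ω.card : ℝ) ^ 2 * (1 - δ) ^ 2 * (Real.pi / t) ^ ((d : ℝ) / 2) / b) := by
      rw [hκ]
      linear_combination (-(ω.card : ℝ) ^ 2 * (1 - δ) ^ 2 / b) * hpow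
    linarith
  refine le_trans ?_ (hlower.trans hupper)
  rw [← intervalIntegral.integral_of_le hTT', intervalIntegral.integral_sub
    (hinv.const_mul _) (hrpow.const_mul _), intervalIntegral.integral_const_mul,
    intervalIntegral.integral_const_mul, integral_inv_of_pos hT hT'0,
    integral_rpow (Or.inl (by linarith [half_pos hd0])), sub_add_cancel]
  gcongr
  rw [div_le_iff₀ (by positivity)]
  have : 0 ≤ T ^ ((d : ℝ) / 2) := by positivity
  have h3 : T' ^ ((d : ℝ) / 2) * (2 / d) * (d / 2) = T' ^ ((d : ℝ) / 2) := by field_simp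
  linarith

lemma volume_real_ball_eq (hd : 1 ≤ d) :
    volume.real (Metric.ball (0 : EuclideanSpace ℝ (Fin d)) 1) =
      Real.pi ^ ((d : ℝ) / 2) * (2 / d) / Real.Gamma ((d : ℝ) / 2) := by
  have hd0 : (0 : ℝ) < d := by exact_mod_cast hd
  have : Nonempty (Fin d) := ⟨⟨0, hd⟩⟩
  have hΓ : 0 < Real.Gamma ((d : ℝ) / 2) := Real.Gamma_pos_of_pos (by positivity)
  rw [measureReal_def, EuclideanSpace.volume_ball]
  simp only [ENNReal.ofReal_one, one_pow, one_mul, Fintype.card_fin]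
  rw [Real.Gamma_add_one (by positivity), ENNReal.toReal_ofReal (by positivity), Real.sqrt_eq_rpow,
    ← Real.rpow_natCast, ← Real.rpow_mul Real.pi_pos.le, one_div, inv_mul_eq_div]
  field_simp

lemma eventually_log_le_minRieszEnergy_div (hd : 1 ≤ d) {A : Set (EuclideanSpace ℝ (Fin d))}
    (hA : IsCompact A) {b : ℝ} (hb : 0 < b) (hvol : volume A < ENNReal.ofReal b) {c : ℝ}
    (hc : c < volume.real (Metric.ball (0 : EuclideanSpace ℝ (Fin d)) 1) / b) :
    ∀ᶠ N : ℕ in atTop, ENNReal.ofReal c ≤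
      minRieszEnergy (d : ℝ) A N / ENNReal.ofReal ((N : ℝ) ^ 2 * Real.log N) := by
  have hd0 : (0 : ℝ) < d := by exact_mod_cast hd
  have hΓ : 0 < Real.Gamma ((d : ℝ) / 2) := Real.Gamma_pos_of_pos (by positivity)
  rw [volume_real_ball_eq hd] at hc
  obtain ⟨δ, hδ0, hδ1, hδc⟩ : ∃ δ : ℝ, 0 < δ ∧ δ < 1 ∧
      c * Real.Gamma ((d : ℝ) / 2) < (1 - δ) ^ 2 * Real.pi ^ ((d : ℝ) / 2) / b * (2 / d) := by
    have hcont : Tendsto (fun δ : ℝ => (1 - δ) ^ 2 * Real.pi ^ ((d : ℝ) / 2) / b * (2 / d))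
        (𝓝[>] 0) (𝓝 ((1 - 0) ^ 2 * Real.pi ^ ((d : ℝ) / 2) / b * (2 / d))) := by
      refine Tendsto.mono_left (ContinuousAt.tendsto (f := fun δ : ℝ =>
        (1 - δ) ^ 2 * Real.pi ^ ((d : ℝ) / 2) / b * (2 / d)) ?_) nhdsWithin_le_nhds
      fun_prop
    have h0 : c * Real.Gamma ((d : ℝ) / 2) <
        (1 - 0) ^ 2 * Real.pi ^ ((d : ℝ) / 2) / b * (2 / d) := by
      have := mul_lt_mul_of_pos_right hc hΓ
      refine this.trans_eq ?_
      field_simp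
      ring
    have h1 : ∀ᶠ ε : ℝ in 𝓝[>] 0, ε < 1 := nhdsWithin_le_nhds (gt_mem_nhds one_pos)
    obtain ⟨δ, ⟨h2, h3⟩, h4⟩ :=
      ((hcont.eventually (lt_mem_nhds h0)).and h1 |>.and self_mem_nhdsWithin).exists
    exact ⟨δ, h4, h3, h2⟩
  obtain ⟨r, hr, hrvol⟩ : ∃ r : ℝ, 0 < r ∧ volume (Metric.cthickening r A) ≤ ENNReal.ofReal b := by
    have := ((tendsto_measure_cthickening_of_isCompact (μ := volume) hA).mono_left
      (nhdsWithin_le_nhds (s := Set.Ioi 0))).eventually (gt_mem_nhds hvol)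
    obtain ⟨r, h1, h2⟩ := (this.and self_mem_nhdsWithin).exists
    exact ⟨r, h2, h1.le⟩
  obtain ⟨T, hT, hTδ⟩ : ∃ T : ℝ, 0 < T ∧
      (2 : ℝ) ^ ((d : ℝ) / 2) * Real.exp (-T * r ^ 2) ≤ δ := by
    have : Tendsto (fun T : ℝ => (2 : ℝ) ^ ((d : ℝ) / 2) * Real.exp (-T * r ^ 2)) atTop
        (𝓝 ((2 : ℝ) ^ ((d : ℝ) / 2) * 0)) := by
      refine (Real.tendsto_exp_atBot.comp ?_).const_mul _
      exact tendsto_neg_atTop_atBot.atBot_mul_const (by positivity)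
    rw [mul_zero] at this
    obtain ⟨T, h1, h2⟩ := ((this.eventually (gt_mem_nhds hδ0)).and (eventually_gt_atTop 0)).exists
    exact ⟨T, h2, h1.le⟩
  set κ : ℝ := (1 - δ) ^ 2 * Real.pi ^ ((d : ℝ) / 2) / b with hκ
  have hlog : Tendsto (fun N : ℕ => Real.log N) atTop atTop :=
    Real.tendsto_log_atTop.comp tendsto_natCast_atTop_atTop
  have hfinal : Tendsto (fun N : ℕ => κ * (2 / d) - (κ * Real.log T + 2 / d) * (Real.log N)⁻¹) atTop
      (𝓝 (κ * (2 / d) - (κ * Real.log T + 2 / d) * 0)) :=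
    (hlog.inv_tendsto_atTop.const_mul _).const_sub _
  rw [mul_zero, sub_zero] at hfinal
  -- The upper cutoff will be `T' = N^(2/d)`, matching the spacing `N^(-1/d)`: the diagonal then
  -- costs `(2/d) N²`, negligible against `N² log N`.
  have hpowlim : Tendsto (fun N : ℕ => (N : ℝ) ^ (2 / (d : ℝ))) atTop atTop :=
    (tendsto_rpow_atTop (by positivity)).comp tendsto_natCast_atTop_atTop
  filter_upwards [hfinal.eventually (lt_mem_nhds hδc), hpowlim.eventually_ge_atTop T,
    hlog.eventually_gt_atTop 0, eventually_gt_atTop 0] with N hN hNT hlN hN0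
  have hN0' : (0 : ℝ) < N := by exact_mod_cast hN0
  have hden : 0 < (N : ℝ) ^ 2 * Real.log N := by positivity
  rw [ENNReal.le_div_iff_mul_le (Or.inl (ENNReal.ofReal_pos.2 hden).ne') (Or.inl ENNReal.ofReal_ne_top)]
  refine le_minRieszEnergy fun ω hωA hωN => ?_
  rw [← ENNReal.ofReal_mul' hden.le]
  refine ENNReal.ofReal_le_ofReal ?_
  have key := rieszEnergy_ge_log hd (ω := ω) hb hrvol hr
    (fun x hx y hy => Metric.mem_cthickening_of_dist_le y x r A (hωA hx)
      (Metric.mem_ball.1 hy).le) hT hNT hδ1.le hTδ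
  rw [hωN, Real.log_div (by positivity) hT.ne', Real.log_rpow hN0', ← Real.rpow_mul hN0'.le] at key
  have h1 : 2 / (d : ℝ) * (d / 2) = 1 := by field_simp
  rw [h1, Real.rpow_one] at key
  refine le_of_mul_le_mul_left (le_trans ?_ key) hΓ
  have h2 := mul_le_mul_of_nonneg_right hN.le hden.le
  have h3 : (κ * (2 / d) - (κ * Real.log T + 2 / d) * (Real.log N)⁻¹) * ((N : ℝ) ^ 2 * Real.log N) =
      (N : ℝ) ^ 2 * κ * (2 / d * Real.log N - Real.log T) - N * (N * (2 / d)) := by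
    field_simp
    ring
  linarith

end Gaussian

/-! ### The hypersingular case: lower bounds by subdivision into cells -/

section Cells

variable {d : ℕ} {s : ℝ}

lemma dist_le_of_mem_unitCell {x y : EuclideanSpace ℝ (Fin d)} (hx : x ∈ unitCell d)
    (hy : y ∈ unitCell d) : dist x y ≤ 2 * d := by
  rw [dist_eq_norm]
  linarith [norm_sub_le x y, norm_le_of_mem_unitCell hx, norm_le_of_mem_unitCell hy]

open scoped Pointwise in
/-- Splitting a configuration according to the cells of side `l` of the lattice `l ℤ^d`. -/
lemma exists_cells_le_rieszEnergy {φ : ℕ → ℝ}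
    (hφ : ∀ ω : Finset (EuclideanSpace ℝ (Fin d)), (ω : Set (EuclideanSpace ℝ (Fin d))) ⊆ unitCell d →
      φ ω.card ≤ rieszEnergy s ω) {l : ℝ} (hl : 0 < l) {A : Set (EuclideanSpace ℝ (Fin d))}
    {ω : Finset (EuclideanSpace ℝ (Fin d))} (hω : (ω : Set (EuclideanSpace ℝ (Fin d))) ⊆ A) :
    ∃ (J : Finset (stdLattice d)) (n : stdLattice d → ℕ), ∑ k ∈ J, n k = ω.card ∧
      (J.card : ℝ≥0∞) ≤ ENNReal.ofReal (l ^ (-(d : ℝ))) *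
        volume (Metric.cthickening (2 * d * l) A) ∧
      l ^ (-s) * ∑ k ∈ J, φ (n k) ≤ rieszEnergy s ω := by
  classical
  set g : EuclideanSpace ℝ (Fin d) → stdLattice d := fun x => ZSpan.floor (stdBasis d) (l⁻¹ • x)
    with hg
  refine ⟨ω.image g, fun k => (ω.filter (g · = k)).card, ?_, ?_, ?_⟩
  · exact (Finset.card_eq_sum_card_fiberwise
      fun x hx => Finset.mem_coe.2 (Finset.mem_image_of_mem g hx)).symm
  · rw [← volume_inv_smul hl]
    have hcount : ((ω.image g).card : ℝ≥0∞) = ∑' k : stdLattice d,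
        ((Subtype.val '' ((ω.image g : Finset (stdLattice d)) : Set (stdLattice d)) :
          Set (EuclideanSpace ℝ (Fin d))).indicator
            (1 : EuclideanSpace ℝ (Fin d) → ℝ≥0∞) (k + 0)) := by
      rw [tsum_eq_sum (s := ω.image g)]
      · rw [Finset.sum_congr rfl fun k hk => Set.indicator_of_mem
          (by rw [add_zero]; exact Set.mem_image_of_mem _ (Finset.mem_coe.2 hk)) _]
        simp
      · intro k hk
        refine Set.indicator_of_notMem (fun h => hk ?_) _
        rw [add_zero] at h
        obtain ⟨k', hk', h⟩ := h
        rwa [← Subtype.ext h]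
    rw [hcount]
    -- An occupied cell of side `l` contains a point of `A` and has diameter at most `2 * d * l`, so
    -- it lies in the thickening.
    refine tsum_indicator_le_volume _ (fun k hk y hy => ?_)
      (Metric.isClosed_cthickening.smul_of_ne_zero (inv_ne_zero hl.ne')).measurableSet
    rw [add_zero] at hk
    obtain ⟨k', hk', h⟩ := hk
    obtain rfl : k' = k := Subtype.ext h
    obtain ⟨x, hx, rfl⟩ := Finset.mem_image.1 (Finset.mem_coe.1 hk')
    rw [Set.mem_inv_smul_set_iff₀ hl.ne']
    refine Metric.mem_cthickening_of_dist_le _ x _ _ (hω hx) ?_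
    have hx' : x = l • ((g x : EuclideanSpace ℝ (Fin d)) + ZSpan.fract (stdBasis d) (l⁻¹ • x)) := by
      rw [ZSpan.fract_apply, hg, add_sub_cancel, smul_inv_smul₀ hl.ne']
    have hdist : dist (l • ((g x : EuclideanSpace ℝ (Fin d)) + y)) x =
        dist y (ZSpan.fract (stdBasis d) (l⁻¹ • x)) * l := by
      nth_rewrite 2 [hx']
      rw [dist_smul₀, dist_add_left, Real.norm_of_nonneg hl.le, mul_comm]
    rw [hdist]
    exact mul_le_mul_of_nonneg_right
      (dist_le_of_mem_unitCell hy (ZSpan.fract_mem_fundamentalDomain _ _)) hl.le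
  · refine le_trans ?_ (sum_rieszEnergy_filter_le s ω g)
    rw [Finset.mul_sum]
    refine Finset.sum_le_sum fun k _ => ?_
    have hdist (x y : EuclideanSpace ℝ (Fin d)) :
        dist (l⁻¹ • x - (k : EuclideanSpace ℝ (Fin d))) (l⁻¹ • y - k) = l⁻¹ * dist x y := by
      rw [dist_sub_right, dist_smul₀, Real.norm_of_nonneg (by positivity)]
    have hinj : Function.Injective
        fun x : EuclideanSpace ℝ (Fin d) => l⁻¹ • x - (k : EuclideanSpace ℝ (Fin d)) :=
      fun x y h => smul_right_injective _ (inv_ne_zero hl.ne') (sub_left_injective h)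
    have h := hφ ((ω.filter (g · = k)).image fun x => l⁻¹ • x - (k : EuclideanSpace ℝ (Fin d))) ?_
    · rw [rieszEnergy_image (by positivity) hdist, Finset.card_image_of_injective _ hinj] at h
      calc _ ≤ l ^ (-s) * (l⁻¹ ^ (-s) * rieszEnergy s (ω.filter (g · = k))) := by gcongr
        _ = rieszEnergy s (ω.filter (g · = k)) := by
          rw [← mul_assoc, ← Real.mul_rpow hl.le (by positivity), mul_inv_cancel₀ hl.ne',
            Real.one_rpow, one_mul]
    · intro y hy
      obtain ⟨x, hx, rfl⟩ := Finset.mem_image.1 (Finset.mem_coe.1 hy)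
      rw [← (Finset.mem_filter.1 hx).2]
      exact ZSpan.fract_mem_fundamentalDomain _ _

/-- Pigeonhole: with at most `N / 2` occupied cells, the sum of `n - 1` over the cells is at least
`N / 2`, and each unit of it costs `(2 d l)^(-s)`, of order `N^(s/d)`. -/
lemma exists_pos_eventually_le_unitCell (hd : 1 ≤ d) (hs : 0 < s) :
    ∃ c > 0, ∀ᶠ N : ℕ in atTop, ENNReal.ofReal c ≤
      minRieszEnergy s (unitCell d) N / ENNReal.ofReal ((N : ℝ) ^ (1 + s / d)) := by
  have hd0 : (0 : ℝ) < d := by exact_mod_cast hd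
  set V := volume (Metric.cthickening (2 * d) (unitCell d)) with hV
  have hVtop : V ≠ ∞ :=
    ((ZSpan.fundamentalDomain_isBounded (stdBasis d)).cthickening.measure_lt_top).ne
  set B : ℝ := V.toReal with hB
  have hB1 : 1 ≤ B := by
    have : (1 : ℝ≥0∞) ≤ V := by
      rw [← volume_unitCell (d := d)]
      exact measure_mono (Metric.self_subset_cthickening _)
    simpa using ENNReal.toReal_mono hVtop this
  have hB0 : 0 < B := by linarith
  refine ⟨(2 * d) ^ (-s) / 2 * (2 * B) ^ (-(s / d)), by positivity, ?_⟩
  filter_upwards [tendsto_natCast_atTop_atTop.eventually_ge_atTop (2 * B)] with N hN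
  have hN0 : (0 : ℝ) < N := by linarith
  have hden : 0 < (N : ℝ) ^ (1 + s / d) := by positivity
  rw [ENNReal.le_div_iff_mul_le (Or.inl (ENNReal.ofReal_pos.2 hden).ne')
    (Or.inl ENNReal.ofReal_ne_top)]
  refine le_minRieszEnergy fun ω hωD hωN => ?_
  rw [← ENNReal.ofReal_mul' hden.le]
  refine ENNReal.ofReal_le_ofReal ?_
  -- Here `q = l^(-d)`, so at most `q * B = N / 2` cells are occupied. The condition `N ≥ 2 * B`
  -- gives `l ≤ 1`, which keeps the thickening inside the fixed one of volume `B`.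
  set q : ℝ := N / (2 * B) with hq
  have hq1 : 1 ≤ q := (one_le_div (by positivity)).2 hN
  have hq0 : 0 < q := by linarith
  set l : ℝ := q ^ (-(1 / (d : ℝ))) with hl
  have hl0 : 0 < l := by positivity
  have hl1 : l ≤ 1 := Real.rpow_le_one_of_one_le_of_nonpos hq1 (by
    rw [neg_nonpos]; positivity)
  have hpow (x : ℝ) : l ^ (-x) = q ^ (x / d) := by
    rw [hl, ← Real.rpow_mul hq0.le]
    congr 1
    field_simp
  obtain ⟨J, n, hJn, hJ, hE⟩ := exists_cells_le_rieszEnergy (s := s)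
    (φ := fun n => (2 * d : ℝ) ^ (-s) * ((n : ℝ) - 1))
    (fun ω hω => card_mul_le_rieszEnergy hs.le (by positivity) ω fun x hx y hy =>
      dist_le_of_mem_unitCell (hω hx) (hω hy)) hl0 hωD
  have hJ' : (J.card : ℝ) ≤ N / 2 := by
    have h1 : (J.card : ℝ≥0∞) ≤ ENNReal.ofReal q * V := by
      refine hJ.trans ?_
      rw [hpow, div_self hd0.ne', Real.rpow_one]
      gcongr
      rw [hV]
      refine measure_mono (Metric.cthickening_mono ?_ _)
      nlinarith
    have h2 := ENNReal.toReal_mono (ENNReal.mul_ne_top ENNReal.ofReal_ne_top hVtop) h1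
    rw [ENNReal.toReal_natCast, ENNReal.toReal_mul, ENNReal.toReal_ofReal hq0.le] at h2
    refine h2.trans (le_of_eq ?_)
    rw [hq, ← hB]
    field_simp
  have hsum : ∑ k ∈ J, (2 * d : ℝ) ^ (-s) * ((n k : ℝ) - 1) = (2 * d) ^ (-s) * (N - J.card) := by
    rw [← Finset.mul_sum, Finset.sum_sub_distrib, ← Nat.cast_sum, hJn, hωN]
    simp
  rw [hsum, hpow] at hE
  refine le_trans ?_ hE
  have h3 : q ^ (s / d) = (N : ℝ) ^ (s / d) * (2 * B) ^ (-(s / d)) := by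
    rw [hq, Real.div_rpow hN0.le (by positivity), Real.rpow_neg (by positivity), div_eq_mul_inv]
  have h4 : (0 : ℝ) < (2 * d) ^ (-s) := by positivity
  have h5 : 0 < q ^ (s / d) := by positivity
  calc _ = q ^ (s / d) * ((2 * d) ^ (-s) * (N / 2)) := by
        rw [Real.rpow_add hN0, Real.rpow_one, h3]
        ring
    _ ≤ _ := by gcongr; linarith

/-- The cell size is fixed while `N` grows, so additive errors per cell disappear in the limit. By
convexity an even distribution over the cells is the worst case, and the powers of `l` cancel. -/
lemma eventually_le_minRieszEnergy_div (hd : 1 ≤ d) (hs : 0 < s) {c : ℝ} (hc0 : 0 < c)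
    (hc : ∀ᶠ n : ℕ in atTop, ENNReal.ofReal c ≤
      minRieszEnergy s (unitCell d) n / ENNReal.ofReal ((n : ℝ) ^ (1 + s / d)))
    {A : Set (EuclideanSpace ℝ (Fin d))} (hA : IsCompact A) {b : ℝ} (hb : 0 < b)
    (hvol : volume A < ENNReal.ofReal b) {c' : ℝ} (hc' : c' < c) :
    ∀ᶠ N : ℕ in atTop, ENNReal.ofReal (c' / b ^ (s / d)) ≤
      minRieszEnergy s A N / ENNReal.ofReal ((N : ℝ) ^ (1 + s / d)) := by
  have hd0 : (0 : ℝ) < d := by exact_mod_cast hd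
  have hp : 0 < 1 + s / d := by positivity
  obtain ⟨n₀, hn₀⟩ := eventually_atTop.1 hc
  -- Subtracting `K` makes the bound trivial for cells with at most `n₀` points, hence valid for
  -- every cardinality.
  set K : ℝ := c * (n₀ : ℝ) ^ (1 + s / d) with hK
  have hK0 : 0 ≤ K := by positivity
  have hφ : ∀ ω : Finset (EuclideanSpace ℝ (Fin d)),
      (ω : Set (EuclideanSpace ℝ (Fin d))) ⊆ unitCell d →
      c * (ω.card : ℝ) ^ (1 + s / d) - K ≤ rieszEnergy s ω := by
    intro ω hω
    rcases le_or_gt ω.card n₀ with h | h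
    · refine le_trans ?_ (rieszEnergy_nonneg s ω)
      rw [sub_nonpos, hK]
      gcongr
    · have hpos : (0 : ℝ) < ω.card := by exact_mod_cast (Nat.zero_le _).trans_lt h
      have hden : 0 < (ω.card : ℝ) ^ (1 + s / d) := by positivity
      have h1 := hn₀ ω.card h.le
      rw [ENNReal.le_div_iff_mul_le (Or.inl (ENNReal.ofReal_pos.2 hden).ne')
        (Or.inl ENNReal.ofReal_ne_top), ← ENNReal.ofReal_mul' hden.le] at h1
      have h2 := (ENNReal.ofReal_le_ofReal_iff (rieszEnergy_nonneg s ω)).1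
        (h1.trans (minRieszEnergy_le hω le_rfl))
      linarith
  obtain ⟨l, hl, hlvol⟩ : ∃ l : ℝ, 0 < l ∧
      volume (Metric.cthickening (2 * d * l) A) ≤ ENNReal.ofReal b := by
    have hlim : Tendsto (fun l : ℝ => volume (Metric.cthickening (2 * d * l) A)) (𝓝[>] 0)
        (𝓝 (volume A)) := by
      refine ((tendsto_measure_cthickening_of_isCompact hA).comp ?_).mono_left nhdsWithin_le_nhds
      simpa using (continuous_const_mul (2 * (d : ℝ))).tendsto 0
    obtain ⟨l, h1, h2⟩ := ((hlim.eventually (gt_mem_nhds hvol)).and self_mem_nhdsWithin).exists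
    exact ⟨l, h2, h1.le⟩
  set K' : ℝ := l ^ (-s) * (K * (l ^ (-(d : ℝ)) * b)) with hK'
  have hfinal : Tendsto (fun N : ℕ => c / b ^ (s / d) - K' * (N : ℝ) ^ (-(1 + s / d))) atTop
      (𝓝 (c / b ^ (s / d) - K' * 0)) :=
    (((tendsto_rpow_neg_atTop hp).comp tendsto_natCast_atTop_atTop).const_mul _).const_sub _
  rw [mul_zero, sub_zero] at hfinal
  have hlt : c' / b ^ (s / d) < c / b ^ (s / d) := by gcongr
  filter_upwards [hfinal.eventually (lt_mem_nhds hlt), eventually_gt_atTop 0] with N hN hN0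
  have hN0' : (0 : ℝ) < N := by exact_mod_cast hN0
  have hden : 0 < (N : ℝ) ^ (1 + s / d) := by positivity
  rw [ENNReal.le_div_iff_mul_le (Or.inl (ENNReal.ofReal_pos.2 hden).ne')
    (Or.inl ENNReal.ofReal_ne_top)]
  refine le_minRieszEnergy fun ω hωA hωN => ?_
  rw [← ENNReal.ofReal_mul' hden.le]
  refine ENNReal.ofReal_le_ofReal ?_
  obtain ⟨J, n, hJn, hJ, hE⟩ := exists_cells_le_rieszEnergy (s := s)
    (φ := fun n => c * (n : ℝ) ^ (1 + s / d) - K) hφ hl hωA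
  have hld : 0 < l ^ (-(d : ℝ)) := by positivity
  have hls : 0 < l ^ (-s) := by positivity
  have hJ' : (J.card : ℝ) ≤ l ^ (-(d : ℝ)) * b := by
    have h1 : (J.card : ℝ≥0∞) ≤ ENNReal.ofReal (l ^ (-(d : ℝ)) * b) := by
      rw [ENNReal.ofReal_mul hld.le]
      exact hJ.trans (by gcongr)
    simpa using ENNReal.toReal_le_of_le_ofReal (by positivity) h1
  have hJ0 : (0 : ℝ) < J.card := by
    have : J.Nonempty := by
      rw [Finset.nonempty_iff_ne_empty]
      rintro rfl
      simp only [Finset.sum_empty, hωN] at hJn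
      omega
    exact_mod_cast this.card_pos
  -- Power-mean inequality for the exponent `1 + s / d ≥ 1`.
  have hmean : (N : ℝ) ^ (1 + s / d) ≤ (J.card : ℝ) ^ (s / d) * ∑ k ∈ J, (n k : ℝ) ^ (1 + s / d) := by
    have := Real.rpow_sum_le_const_mul_sum_rpow_of_nonneg (p := 1 + s / d) J
      (f := fun k => (n k : ℝ)) (by have : 0 < s / d := by positivity
                                    linarith) fun _ _ => Nat.cast_nonneg _
    rwa [← Nat.cast_sum, hJn, hωN, add_sub_cancel_left] at this
  have hJs : (J.card : ℝ) ^ (s / d) ≤ l ^ (-s) * b ^ (s / d) := by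
    calc (J.card : ℝ) ^ (s / d) ≤ (l ^ (-(d : ℝ)) * b) ^ (s / d) := by gcongr
      _ = l ^ (-s) * b ^ (s / d) := by
        rw [Real.mul_rpow hld.le hb.le, ← Real.rpow_mul hl.le]
        congr 2
        field_simp
  have hsum : ∑ k ∈ J, (c * (n k : ℝ) ^ (1 + s / d) - K) =
      c * (∑ k ∈ J, (n k : ℝ) ^ (1 + s / d)) - K * J.card := by
    rw [Finset.sum_sub_distrib, ← Finset.mul_sum, Finset.sum_const, nsmul_eq_mul, mul_comm K]
  rw [hsum] at hE
  set Sn : ℝ := ∑ k ∈ J, (n k : ℝ) ^ (1 + s / d) with hSn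
  have hSn0 : 0 ≤ Sn := Finset.sum_nonneg fun _ _ => by positivity
  have hbs : 0 < b ^ (s / d) := by positivity
  have h1 : (N : ℝ) ^ (1 + s / d) / b ^ (s / d) ≤ l ^ (-s) * Sn := by
    rw [div_le_iff₀ hbs]
    calc _ ≤ (J.card : ℝ) ^ (s / d) * Sn := hmean
      _ ≤ l ^ (-s) * b ^ (s / d) * Sn := by gcongr
      _ = _ := by ring
  have h2 : l ^ (-s) * (K * J.card) ≤ K' := by rw [hK']; gcongr
  have h3 : c * ((N : ℝ) ^ (1 + s / d) / b ^ (s / d)) ≤ c * (l ^ (-s) * Sn) := by gcongr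
  have h4 := mul_le_mul_of_nonneg_right hN.le hden.le
  have h5 : (c / b ^ (s / d) - K' * (N : ℝ) ^ (-(1 + s / d))) * (N : ℝ) ^ (1 + s / d) =
      c * ((N : ℝ) ^ (1 + s / d) / b ^ (s / d)) - K' := by
    rw [Real.rpow_neg hN0'.le]
    field_simp
  linarith

end Cells

/-! ### The hypersingular case: upper bounds by periodization -/

section Periodization

variable {d : ℕ} {s : ℝ}

lemma eventually_minRieszEnergy_div_le (hd : 1 ≤ d) {A : Set (EuclideanSpace ℝ (Fin d))}
    (hA : IsCompact A) {a : ℝ} (ha : 0 < a) (hvol : volume A = ENNReal.ofReal a)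
    {F : Finset (EuclideanSpace ℝ (Fin d))}
    (hF : (F : Set (EuclideanSpace ℝ (Fin d))) ⊆ unitCell d) (hne : F.Nonempty)
    {e : ℝ} (he0 : 0 < e)
    (he : ∀ R, ∑ f ∈ F, latticePotential s R F f ≤ ENNReal.ofReal e)
    {ε : ℝ} (hε : 0 < ε) (hε1 : ε < 1) :
    ∀ᶠ N : ℕ in atTop, minRieszEnergy s A N / ENNReal.ofReal ((N : ℝ) ^ (1 + s / d)) ≤
      ENNReal.ofReal ((1 + ε) * a * e / ((1 - ε) * F.card * a) ^ (1 + s / d)) := by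
  have hc : 0 < (1 - ε) * F.card * a := by
    have : 0 < 1 - ε := by linarith
    have : (0 : ℝ) < F.card := by exact_mod_cast hne.card_pos
    positivity
  filter_upwards [eventually_minRieszEnergy_le hd hA ha hvol hF hne hε hε1] with N hN
  refine ENNReal.div_le_of_le_mul ?_
  rw [← ENNReal.ofReal_mul (by positivity)]
  refine (hN s _ e (fun x hx y hy => mul_le_mul_of_nonneg_right
    (Metric.dist_le_diam_of_mem hA.isBounded hx hy) (by positivity)) he0 (he _)).trans
    (ENNReal.ofReal_le_ofReal (le_of_eq ?_))
  rw [Real.div_rpow (Nat.cast_nonneg _) hc.le]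
  ring

lemma sum_truncKernel_le (s R : ℝ) (F : Finset (EuclideanSpace ℝ (Fin d))) :
    ∑ f ∈ F, ∑ f' ∈ F, truncKernel s R (f - f') ≤ ENNReal.ofReal (rieszEnergy s F) := by
  classical
  rw [rieszEnergy_eq, ENNReal.ofReal_sum_of_nonneg
    fun _ _ => Finset.sum_nonneg fun _ _ => by positivity]
  refine Finset.sum_le_sum fun f hf => ?_
  rw [← Finset.sum_erase F (a := f) (by rw [sub_self, truncKernel_zero]),
    ENNReal.ofReal_sum_of_nonneg fun _ _ => by positivity]
  refine Finset.sum_le_sum fun f' _ => (truncKernel_le _ _ _).trans (le_of_eq ?_)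
  rw [Real.rpow_neg (norm_nonneg _), one_div, dist_comm, dist_eq_norm]

open Classical in
-- The terms `k = 0` give the energy of the shrunken configuration. For `k ≠ 0` the gap opened by
-- shrinking bounds each kernel value by `(η ‖k‖)^(-s)`, whatever the pair of points.
lemma sum_latticePotential_le (hs : 0 < s) {η : ℝ} (hη0 : 0 < η) (hη1 : η < 1)
    {ω : Finset (EuclideanSpace ℝ (Fin d))}
    (hω : (ω : Set (EuclideanSpace ℝ (Fin d))) ⊆ unitCell d) (R : ℝ) :
    ∑ f ∈ ω.image ((1 - η) • ·), latticePotential s R (ω.image ((1 - η) • ·)) f ≤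
      ENNReal.ofReal ((1 - η) ^ (-s) * rieszEnergy s ω) + (ω.card : ℝ≥0∞) ^ 2 *
        (ENNReal.ofReal (η ^ (-s)) *
          ∑' k : stdLattice d, ENNReal.ofReal (‖(k : EuclideanSpace ℝ (Fin d))‖ ^ (-s))) := by
  set F := ω.image ((1 - η) • ·) with hF
  set Z : ℝ≥0∞ := ENNReal.ofReal (η ^ (-s)) *
    ∑' k : stdLattice d, ENNReal.ofReal (‖(k : EuclideanSpace ℝ (Fin d))‖ ^ (-s)) with hZ
  have h1η : 0 < 1 - η := by linarith
  have hpair : ∀ f ∈ F, ∀ f' ∈ F,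
      ∑' k : stdLattice d, truncKernel s R (f - f' - (k : EuclideanSpace ℝ (Fin d))) ≤
        truncKernel s R (f - f') + Z := by
    intro f hf f' hf'
    obtain ⟨x, hx, rfl⟩ := Finset.mem_image.1 hf
    obtain ⟨y, hy, rfl⟩ := Finset.mem_image.1 hf'
    rw [← tsum_ite_eq (0 : stdLattice d) (fun _ => truncKernel s R ((1 - η) • x - (1 - η) • y)), hZ,
      ← ENNReal.tsum_mul_left, ← ENNReal.tsum_add]
    refine ENNReal.tsum_le_tsum fun k => ?_
    by_cases hk : k = 0
    · simp [hk]
    · rw [if_neg hk, zero_add, ← ENNReal.ofReal_mul (by positivity),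
        ← Real.mul_rpow hη0.le (norm_nonneg _)]
      refine (truncKernel_le _ _ _).trans (ENNReal.ofReal_le_ofReal ?_)
      refine Real.rpow_le_rpow_of_nonpos (mul_pos hη0 (norm_pos_iff.2 ?_))
        (norm_lattice_le hη0 hη1 (hω hx) (hω hy) k) (by linarith)
      simpa using hk
  have hinj : Function.Injective fun x : EuclideanSpace ℝ (Fin d) => (1 - η) • x :=
    smul_right_injective _ h1η.ne'
  calc ∑ f ∈ F, latticePotential s R F f
      ≤ ∑ f ∈ F, ∑ f' ∈ F, (truncKernel s R (f - f') + Z) :=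
        Finset.sum_le_sum fun f hf => Finset.sum_le_sum fun f' hf' => hpair f hf f' hf'
    _ = ∑ f ∈ F, ∑ f' ∈ F, truncKernel s R (f - f') + (F.card : ℝ≥0∞) ^ 2 * Z := by
        simp only [Finset.sum_add_distrib, Finset.sum_const, nsmul_eq_mul]
        ring
    _ ≤ _ := by
        rw [hF, Finset.card_image_of_injective _ hinj, ← hF]
        gcongr
        rw [← rieszEnergy_image h1η (f := fun x : EuclideanSpace ℝ (Fin d) => (1 - η) • x)
          (fun x y => by rw [dist_smul₀, Real.norm_of_nonneg h1η.le])]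
        exact sum_truncKernel_le s R F

/-- A single good `n` yields a periodic configuration that can be scaled to any large `N`, so
smallness along a subsequence on the cube becomes smallness for all large `N` on `A`. -/
lemma frequently_lt_imp_eventually_le (hd : 1 ≤ d) (hs : (d : ℝ) < s) {C : ℝ} (hC : 0 < C)
    (hfreq : ∀ c, C < c → ∃ᶠ n : ℕ in atTop,
      minRieszEnergy s (unitCell d) n / ENNReal.ofReal ((n : ℝ) ^ (1 + s / d)) < ENNReal.ofReal c)
    {A : Set (EuclideanSpace ℝ (Fin d))} (hA : IsCompact A) {a : ℝ} (ha : 0 < a)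
    (hvol : volume A = ENNReal.ofReal a) {c : ℝ} (hc : C / a ^ (s / d) < c) :
    ∀ᶠ N : ℕ in atTop, minRieszEnergy s A N / ENNReal.ofReal ((N : ℝ) ^ (1 + s / d)) ≤
      ENNReal.ofReal c := by
  classical
  have hd0 : (0 : ℝ) < d := by exact_mod_cast hd
  have hs0 : 0 < s := hd0.trans hs
  have hsd : 1 < s / d := (one_lt_div hd0).2 hs
  set p : ℝ := 1 + s / d with hp
  -- The same `ε` is the loss in averaging, the amount of shrinking, and the excess over `C`.
  obtain ⟨ε, hε, hε1, hεc⟩ : ∃ ε : ℝ, 0 < ε ∧ ε < 1 ∧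
      (1 + ε) * a / ((1 - ε) * a) ^ p * ((1 - ε) ^ (-s) * (C + ε)) < c := by
    have hcont : ContinuousAt
        (fun ε : ℝ => (1 + ε) * a / ((1 - ε) * a) ^ p * ((1 - ε) ^ (-s) * (C + ε))) 0 := by
      have h1 : ContinuousAt (fun ε : ℝ => ((1 - ε) * a) ^ p) 0 :=
        ContinuousAt.rpow_const (by fun_prop) (Or.inl (by simpa using ha.ne'))
      have h2 : ContinuousAt (fun ε : ℝ => (1 - ε) ^ (-s)) 0 :=
        ContinuousAt.rpow_const (by fun_prop) (Or.inl (by simp))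
      refine ContinuousAt.mul (ContinuousAt.div (by fun_prop) h1 ?_) (h2.mul (by fun_prop))
      simpa using (Real.rpow_pos_of_pos ha p).ne'
    have h0 : (1 + 0) * a / ((1 - 0) * a) ^ p * ((1 - 0) ^ (-s) * (C + 0)) < c := by
      convert hc using 1
      rw [hp, sub_zero, one_mul, add_zero, one_mul, Real.rpow_add ha, Real.rpow_one, Real.one_rpow]
      field_simp
      simp
    have h1 : ∀ᶠ ε : ℝ in 𝓝[>] 0, ε < 1 := nhdsWithin_le_nhds (gt_mem_nhds one_pos)
    obtain ⟨ε, ⟨h2, h3⟩, h4⟩ := (((hcont.tendsto.mono_left nhdsWithin_le_nhds).eventually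
      (gt_mem_nhds h0)).and h1 |>.and self_mem_nhdsWithin).exists
    exact ⟨ε, h4, h3, h2⟩
  have h1ε : 0 < 1 - ε := by linarith
  set Z : ℝ≥0∞ := ENNReal.ofReal (ε ^ (-s)) *
    ∑' k : stdLattice d, ENNReal.ofReal (‖(k : EuclideanSpace ℝ (Fin d))‖ ^ (-s)) with hZ
  have hZtop : Z ≠ ∞ := ENNReal.mul_ne_top ENNReal.ofReal_ne_top (tsum_lattice_rpow_lt_top hs).ne
  have hlim : Tendsto (fun n : ℕ => (1 + ε) * a / ((1 - ε) * a) ^ p *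
      ((1 - ε) ^ (-s) * (C + ε) + Z.toReal * (n : ℝ) ^ (-(s / d - 1)))) atTop
      (𝓝 ((1 + ε) * a / ((1 - ε) * a) ^ p * ((1 - ε) ^ (-s) * (C + ε) + Z.toReal * 0))) :=
    ((((tendsto_rpow_neg_atTop (by linarith)).comp tendsto_natCast_atTop_atTop).const_mul
      _).const_add _).const_mul _
  rw [mul_zero, add_zero] at hlim
  -- With `ε`, and so `Z`, fixed, a large `n` makes the cross-cell term `Z * n^(1 - s/d)` negligible
  -- because `s > d`.
  obtain ⟨n, hn, hnc, hn0⟩ := ((hfreq (C + ε) (by linarith)).and_eventually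
    ((hlim.eventually (gt_mem_nhds hεc)).and (eventually_gt_atTop 0))).exists
  have hn0' : (0 : ℝ) < n := by exact_mod_cast hn0
  have hden : 0 < (n : ℝ) ^ p := by positivity
  rw [ENNReal.div_lt_iff (Or.inl (ENNReal.ofReal_pos.2 hden).ne') (Or.inl ENNReal.ofReal_ne_top),
    ← ENNReal.ofReal_mul' hden.le] at hn
  obtain ⟨ω, hωD, hωn, hωE⟩ := exists_rieszEnergy_lt hn
  have hωE' : rieszEnergy s ω ≤ (C + ε) * (n : ℝ) ^ p :=
    ((ENNReal.ofReal_lt_ofReal_iff (by positivity)).1 hωE).le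
  set F := ω.image ((1 - ε) • ·) with hF
  have hinj : Function.Injective fun x : EuclideanSpace ℝ (Fin d) => (1 - ε) • x :=
    smul_right_injective _ h1ε.ne'
  have hFcard : F.card = n := by rw [hF, Finset.card_image_of_injective _ hinj, hωn]
  have hFD : (F : Set (EuclideanSpace ℝ (Fin d))) ⊆ unitCell d := by
    intro y hy
    obtain ⟨x, hx, rfl⟩ := Finset.mem_image.1 (Finset.mem_coe.1 hy)
    have hx := mem_unitCell.1 (hωD hx)
    refine mem_unitCell.2 fun i => ?_
    simp only [PiLp.smul_apply, smul_eq_mul]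
    exact ⟨mul_nonneg h1ε.le (hx i).1, by nlinarith [hx i]⟩
  have hFne : F.Nonempty := Finset.card_pos.1 (by omega)
  set e : ℝ := (1 - ε) ^ (-s) * ((C + ε) * (n : ℝ) ^ p) + (n : ℝ) ^ 2 * Z.toReal with he
  have he0 : 0 < e := by positivity
  have hpot (R) : ∑ f ∈ F, latticePotential s R F f ≤ ENNReal.ofReal e := by
    refine (sum_latticePotential_le hs0 hε hε1 hωD R).trans ?_
    rw [he, ENNReal.ofReal_add (by positivity) (by positivity), ENNReal.ofReal_mul (p := (n : ℝ) ^ 2)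
      (by positivity), ENNReal.ofReal_toReal hZtop, hωn, ENNReal.ofReal_pow (Nat.cast_nonneg _),
      ENNReal.ofReal_natCast]
    gcongr
  filter_upwards [eventually_minRieszEnergy_div_le hd hA ha hvol hFD hFne he0 hpot hε hε1] with N hN
  refine hN.trans (ENNReal.ofReal_le_ofReal (le_trans (le_of_eq ?_) hnc.le))
  rw [hFcard, he, ← hp, mul_right_comm (1 - ε), Real.mul_rpow (by positivity) hn0'.le]
  have h2 : (n : ℝ) ^ (-(s / d - 1)) = (n : ℝ) ^ 2 / (n : ℝ) ^ p := by
    rw [← Real.rpow_natCast, ← Real.rpow_sub hn0', hp]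
    congr 1
    push_cast
    ring
  rw [h2]
  field_simp

/-- The half-open cube is not compact, so the construction with `F = {0}` is applied to a compact
subset of positive volume; a larger set has smaller minimal energy. -/
lemma exists_eventually_unitCell_le (hd : 1 ≤ d) (hs : (d : ℝ) < s) :
    ∃ c : ℝ, ∀ᶠ N : ℕ in atTop, minRieszEnergy s (unitCell d) N /
      ENNReal.ofReal ((N : ℝ) ^ (1 + s / d)) ≤ ENNReal.ofReal c := by
  obtain ⟨K, hKD, hK, hK0⟩ := measurableSet_unitCell.exists_lt_isCompact (μ := volume)
    (r := 0) (by rw [volume_unitCell (d := d)]; exact one_pos)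
  have hKtop : volume K ≠ ∞ := hK.measure_lt_top.ne
  set Z : ℝ≥0∞ := ∑' k : stdLattice d, ENNReal.ofReal (‖(k : EuclideanSpace ℝ (Fin d))‖ ^ (-s))
  have hZ : Z ≠ ∞ := (tsum_lattice_rpow_lt_top hs).ne
  refine ⟨_, (eventually_minRieszEnergy_div_le (s := s) (e := Z.toReal + 1) (ε := 1 / 2) hd hK
    (ENNReal.toReal_pos hK0.ne' hKtop) (ENNReal.ofReal_toReal hKtop).symm
    singleton_zero_subset_unitCell (Finset.singleton_nonempty _) (by positivity) (fun R => ?_)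
    (by norm_num) (by norm_num)).mono fun N hN =>
      (ENNReal.div_le_div_right (minRieszEnergy_anti hKD N) _).trans hN⟩
  rw [latticePotential_singleton_zero]
  refine (ENNReal.tsum_le_tsum fun k => truncKernel_le _ _ _).trans ?_
  rw [ENNReal.le_ofReal_iff_toReal_le hZ (by positivity)]
  exact le_add_of_nonneg_right zero_le_one

end Periodization

/-! ### The limits -/

section Limits

/-- Lower bounds are available only with some `b` above the volume; continuity in `b` closes the
gap. For `a = 0` they alone force the limit `∞`, as `b` can be taken arbitrarily small. -/
lemma tendsto_ofReal_div_rpow {f : ℕ → ℝ≥0∞} {C q : ℝ} (hC : 0 < C) (hq : 0 < q) {a : ℝ≥0∞}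
    (ha : a ≠ ∞)
    (hlow : ∀ b : ℝ, 0 < b → a < ENNReal.ofReal b → ∀ c, c < C / b ^ q →
      ∀ᶠ N in atTop, ENNReal.ofReal c ≤ f N)
    (hup : ∀ a₀ : ℝ, 0 < a₀ → a = ENNReal.ofReal a₀ → ∀ c, C / a₀ ^ q < c →
      ∀ᶠ N in atTop, f N ≤ ENNReal.ofReal c) :
    Tendsto f atTop (𝓝 (ENNReal.ofReal C / a ^ q)) := by
  rcases eq_or_ne a 0 with rfl | h0
  · rw [ENNReal.zero_rpow_of_pos hq, ENNReal.div_zero (ENNReal.ofReal_pos.2 hC).ne',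
      ENNReal.tendsto_nhds_top_iff_nnreal]
    intro x
    have hx : (0 : ℝ) < x + 2 := by positivity
    -- The solution `b` of `C / b ^ q = x + 2`.
    have hb : 0 < (C / (x + 2)) ^ q⁻¹ := by positivity
    have hlt : (x : ℝ) + 1 < C / ((C / (x + 2)) ^ q⁻¹) ^ q := by
      rw [Real.rpow_inv_rpow (by positivity) hq.ne', div_div_cancel₀ hC.ne']
      linarith
    filter_upwards [hlow _ hb (ENNReal.ofReal_pos.2 hb) _ hlt] with N hN
    refine lt_of_lt_of_le ?_ hN
    rw [ENNReal.lt_ofReal_iff_toReal_lt ENNReal.coe_ne_top]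
    simp
  · obtain ⟨a₀, ha₀, rfl⟩ : ∃ a₀ : ℝ, 0 < a₀ ∧ a = ENNReal.ofReal a₀ :=
      ⟨a.toReal, ENNReal.toReal_pos h0 ha, (ENNReal.ofReal_toReal ha).symm⟩
    rw [ENNReal.ofReal_rpow_of_pos ha₀, ← ENNReal.ofReal_div_of_pos (by positivity), tendsto_order]
    refine ⟨fun x hx => ?_, fun x hx => ?_⟩
    · obtain ⟨c, hc0, hxc, hc⟩ := ENNReal.lt_iff_exists_real_btwn.1 hx
      have hc' : c < C / a₀ ^ q := (ENNReal.ofReal_lt_ofReal_iff (by positivity)).1 hc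
      have hcont : ContinuousAt (fun b : ℝ => C / b ^ q) a₀ :=
        continuousAt_const.div (Real.continuousAt_rpow_const _ _ (Or.inl ha₀.ne')) (by positivity)
      obtain ⟨b, hb1, hb2⟩ := (((hcont.tendsto.mono_left nhdsWithin_le_nhds).eventually
        (lt_mem_nhds hc')).and (self_mem_nhdsWithin (s := Set.Ioi a₀))).exists
      have hb2 : a₀ < b := hb2
      filter_upwards [hlow b (ha₀.trans hb2)
        ((ENNReal.ofReal_lt_ofReal_iff (ha₀.trans hb2)).2 hb2) c hb1] with N hN
      exact hxc.trans_le hN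
    · obtain ⟨c, hc0, hc, hcx⟩ := ENNReal.lt_iff_exists_real_btwn.1 hx
      have hc' : C / a₀ ^ q < c := (ENNReal.ofReal_lt_ofReal_iff_of_nonneg (by positivity)).1 hc
      filter_upwards [hup a₀ ha₀ rfl c hc'] with N hN
      exact hN.trans_lt hcx

variable {d : ℕ}

lemma tendsto_minRieszEnergy_log (hd : 1 ≤ d) {A : Set (EuclideanSpace ℝ (Fin d))}
    (hA : IsCompact A) :
    Tendsto (fun N : ℕ =>
        minRieszEnergy (d : ℝ) A N / ENNReal.ofReal ((N : ℝ) ^ 2 * Real.log (N : ℝ)))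
      atTop (𝓝 (volume (Metric.closedBall (0 : EuclideanSpace ℝ (Fin d)) 1) / volume A)) := by
  have : Nonempty (Fin d) := ⟨⟨0, hd⟩⟩
  have hball : volume (Metric.closedBall (0 : EuclideanSpace ℝ (Fin d)) 1) =
      ENNReal.ofReal (volume.real (Metric.ball (0 : EuclideanSpace ℝ (Fin d)) 1)) := by
    rw [Measure.addHaar_closedBall_eq_addHaar_ball, ofReal_measureReal]
  have hv : 0 < volume.real (Metric.ball (0 : EuclideanSpace ℝ (Fin d)) 1) :=
    ENNReal.toReal_pos (Metric.measure_ball_pos _ _ one_pos).ne' measure_ball_lt_top.ne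
  have key := tendsto_ofReal_div_rpow hv one_pos hA.measure_lt_top.ne
    (f := fun N : ℕ =>
      minRieszEnergy (d : ℝ) A N / ENNReal.ofReal ((N : ℝ) ^ 2 * Real.log (N : ℝ)))
    (fun b hb hvol c hc => eventually_log_le_minRieszEnergy_div hd hA hb hvol (by simpa using hc))
    (fun a ha hvol c hc => eventually_minRieszEnergy_div_le_log hd hA ha hvol (by simpa using hc))
  rwa [ENNReal.rpow_one, ← hball] at key

lemma exists_tendsto_minRieszEnergy (hd : 1 ≤ d) {s : ℝ} (hs : (d : ℝ) < s) :
    ∃ C : ℝ, 0 < C ∧ ∀ A : Set (EuclideanSpace ℝ (Fin d)), IsCompact A →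
      Tendsto (fun N : ℕ =>
          minRieszEnergy s A N / ENNReal.ofReal ((N : ℝ) ^ (1 + s / (d : ℝ))))
        atTop (𝓝 (ENNReal.ofReal C / volume A ^ (s / (d : ℝ)))) := by
  have hd0 : (0 : ℝ) < d := by exact_mod_cast hd
  have hs0 : 0 < s := hd0.trans hs
  set f : ℕ → ℝ≥0∞ := fun N =>
    minRieszEnergy s (unitCell d) N / ENNReal.ofReal ((N : ℝ) ^ (1 + s / (d : ℝ))) with hf
  -- The constant is a lower limit: no convergence on the cube is assumed, since both bounds below
  -- refer only to this value.
  set L : ℝ≥0∞ := liminf f atTop with hL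
  obtain ⟨c₁, hc₁⟩ := exists_eventually_unitCell_le hd hs
  obtain ⟨c₀, hc₀, hc₀'⟩ := exists_pos_eventually_le_unitCell hd hs0
  have hLtop : L ≠ ∞ := by
    refine ne_top_of_le_ne_top ENNReal.ofReal_ne_top (b := ENNReal.ofReal c₁) ?_
    exact liminf_le_of_frequently_le' hc₁.frequently
  have hL0 : 0 < L := (ENNReal.ofReal_pos.2 hc₀).trans_le (le_liminf_of_le (by isBoundedDefault) hc₀')
  have hC : 0 < L.toReal := ENNReal.toReal_pos hL0.ne' hLtop
  refine ⟨L.toReal, hC, fun A hA => tendsto_ofReal_div_rpow hC (by positivity)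
    hA.measure_lt_top.ne (fun b hb hvol c hc => ?_) fun a ha hvol c hc => ?_⟩
  · have hbs : 0 < b ^ (s / d) := by positivity
    rw [lt_div_iff₀ hbs] at hc
    -- The maximum with `0` makes `c₂` positive even when the requested bound `c` is negative.
    obtain ⟨c₂, h1, h2⟩ := exists_between (max_lt hc hC)
    have hc₂ : 0 < c₂ := (le_max_right _ _).trans_lt h1
    have hev : ∀ᶠ n in atTop, ENNReal.ofReal c₂ ≤ f n := by
      refine (eventually_lt_of_lt_liminf ?_).mono fun n hn => le_of_lt hn
      rwa [← hL, ENNReal.ofReal_lt_iff_lt_toReal hc₂.le hLtop]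
    have := eventually_le_minRieszEnergy_div hd hs0 hc₂ hev hA hb hvol
      ((le_max_left _ _).trans_lt h1)
    rwa [mul_div_cancel_right₀ _ hbs.ne'] at this
  · refine frequently_lt_imp_eventually_le hd hs hC (fun c' hc' => ?_) hA ha hvol hc
    refine frequently_lt_of_liminf_lt (by isBoundedDefault) ?_
    rw [← hf, ← hL]
    exact (ENNReal.lt_ofReal_iff_toReal_lt hLtop).2 hc'

end Limits

end

/-- `μHE[d]` is `d`-dimensional Hausdorff measure, normalized so that it is Lebesgue measure on
`ℝ^d`. All quotients are taken in `[0, ∞]`, so that `c / 0 = ∞` for `c > 0`. -/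
theorem theorem2p1 (d : ℕ) (hd : 1 ≤ d) :
    (∀ A : Set (EuclideanSpace ℝ (Fin d)), IsCompact A →
      Tendsto (fun N : ℕ =>
          minRieszEnergy (d : ℝ) A N / ENNReal.ofReal ((N : ℝ) ^ 2 * Real.log (N : ℝ)))
        atTop
        (𝓝 (μHE[d] (Metric.closedBall (0 : EuclideanSpace ℝ (Fin d)) 1) / μHE[d] A)) ∧
      (μHE[d] A = 0 →
        Tendsto (fun N : ℕ =>
            minRieszEnergy (d : ℝ) A N / ENNReal.ofReal ((N : ℝ) ^ 2 * Real.log (N : ℝ)))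
          atTop (𝓝 ∞))) ∧
    (∀ s : ℝ, (d : ℝ) < s → ∃ C : ℝ, 0 < C ∧
      ∀ A : Set (EuclideanSpace ℝ (Fin d)), IsCompact A →
        Tendsto (fun N : ℕ =>
            minRieszEnergy s A N / ENNReal.ofReal ((N : ℝ) ^ (1 + s / (d : ℝ))))
          atTop
          (𝓝 (ENNReal.ofReal C / μHE[d] A ^ (s / (d : ℝ)))) ∧
        (μHE[d] A = 0 →
          Tendsto (fun N : ℕ =>
              minRieszEnergy s A N / ENNReal.ofReal ((N : ℝ) ^ (1 + s / (d : ℝ))))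
            atTop (𝓝 ∞))) := by
  rw [EuclideanSpace.euclideanHausdorffMeasure_eq_volume]
  have hd0 : (0 : ℝ) < d := by exact_mod_cast hd
  refine ⟨fun A hA => ?_, fun s hs => ?_⟩
  · have h := tendsto_minRieszEnergy_log hd hA
    refine ⟨h, fun h0 => ?_⟩
    rwa [h0, ENNReal.div_zero (Metric.measure_closedBall_pos _ _ one_pos).ne'] at h
  · obtain ⟨C, hC, H⟩ := exists_tendsto_minRieszEnergy hd hs
    refine ⟨C, hC, fun A hA => ⟨H A hA, fun h0 => ?_⟩⟩
    have h := H A hA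
    rwa [h0, ENNReal.zero_rpow_of_pos (div_pos (hd0.trans hs) hd0),
      ENNReal.div_zero (ENNReal.ofReal_pos.2 hC).ne'] at h
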